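/- There are absolute constants $c>0$ and $d_0>0$ such that the following holds. Let $p=p(n)\in[0,1]$ and put $d=d(n)=n^2p(n)$, where $d(n)\ge d_0$ for all large $n$ (in particular $d\geq d_0$ may be any constant). Pick an assignment $\varphi$ to the variables $V=\{x_1,\dots,x_n\}$ uniformly at random, and let $\mathcal F$ be the random 3CNF formula that contains each of the $7\binom n3$ clauses (on three different variables) satisfied by $\varphi$ independently with probability $p$. Given $\mathcal F$, let the vector $\alpha$ of initial clause-variable messages, one value in $\{0,1\}$ for each pair $C\to x$ with $C\in\mathcal F$ and $x$ a variable of $C$, be uniformly random, and let $\pi$ be an independent uniformly random ordering of these $3\#\mathcal F$ edges $C\to x$. Let $\mathcal H=\mathcal H(\mathcal F,\varphi,\alpha,\pi)\subseteq V$ be the core defined below. Then $$\Pr\left[\#\mathcal H\ge(1-e^{-cd})\,n\right]\longrightarrow 1\qquad(n\to\infty).$$ Definitions. A variable supports a clause if it is the only variable that satisfies it under $\varphi$. For a variable $y$ let $N^s(y)$ be the set of clauses of $\mathcal F$ that $y$ supports, $N^{++}(y)$ the set of clauses of $\mathcal F$ that contain the literal of $y$ which is true under $\varphi$ but are not supported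 by $y$, and $N^-(y)$ the set of clauses of $\mathcal F$ that contain the literal of $y$ which is false under $\varphi$. For a set $\mathcal C$ of clauses let $\mathcal C_{<i}(y)$ be the set of edges $C\to y$ with $C\in\mathcal C$ that stand before place $i$ in $\pi$, let $\mathbf 1_\alpha(\mathcal C_{<i}(y))$ be the set of those along which $\alpha$ is $1$, and let $\mathbf 1_\alpha(\mathcal C\to y)$ be the set of all edges $C\to y$, $C\in\mathcal C$, along which $\alpha$ is $1$. A variable $x$ is stable if, for every edge $C\to x$ (in place $i$ of $\pi$, say) and each of the two other variables $y$ of $C$, (a) $|\#N^{++}(y)_{<i}(y)-\#N^{-}(y)_{<i}(y)|\le d/30$, (b) $|\#N^{++}(y)-\#N^-(y)|\le d/30$, and (c) $\#N^s(y)\ge d/3$. A variable $x$ is violated if, for some edge $C\to x$ (in place $i$ of $\pi$, say) and one of the two other variables $y$ of $C$, at least one of the following holds: (a) $|\#\mathbf 1_\alpha(N^{++}(y)_{<i}(y))-\#\mathbf 1_\alpha(N^-(y)_{<i}(y))|>d/30$, (b) $|\#\mathbf 1_\alpha(N^{++}(y)\to y)-\#\mathbf 1_\alpha(N^-(y)\to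 y)|>d/30$, (c) $\#\mathbf 1_\alpha(N^s(y)\to y)<d/7$. For $A\subseteq V$ let $\mathcal F[A]$ be the set of clauses of $\mathcal F$ all of whose variables lie in $A$. The core is obtained as follows. Start with $H_0=V\setminus(A_1\cup A_2\cup A_3)$, where $A_1$ is the set of variables that support at most $d/3$ clauses of $\mathcal F$, $A_2$ the set of variables that are not stable, and $A_3$ the set of stable variables that are violated. While there is a variable in the current set $H_i$ that supports less than $d/4$ clauses of $\mathcal F[H_i]$ or appears in more than $d/30$ clauses of $\mathcal F$ that are not in $\mathcal F[H_i]$, remove one such variable to obtain $H_{i+1}$. The final set is $\mathcal H$. (The statement holds simultaneously for all possible orders of the removals.) -/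

import Mathlib

open Filter Topology

namespace PlantedSAT

noncomputable section

open scoped Classical

/-! ### 3CNF formulas -/

/-- A literal over `n` variables: `(x, true)` is the literal `x`, `(x, false)` is its negation. -/
abbrev Literal (n : ℕ) := Fin n × Bool

/-- A 3CNF clause: a set of three literals over three different variables. -/
abbrev Clause (n : ℕ) :=
  {C : Finset (Literal n) // C.card = 3 ∧ (C.image Prod.fst).card = 3}

/-- A 3CNF formula is a finite set of clauses. -/
abbrev Formula (n : ℕ) := Finset (Clause n)

abbrev Assignment (n : ℕ) := Fin n → Bool

variable {n : ℕ}

/-- The set of variables appearing in `C`. -/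
def vars (C : Clause n) : Finset (Fin n) := C.1.image Prod.fst

/-- The clause `C` is satisfied by `φ`. -/
def Satisfies (φ : Assignment n) (C : Clause n) : Prop := ∃ l ∈ C.1, φ l.1 = l.2

/-- The variable `x` supports `C` with respect to the (total) assignment `φ`: it is the only
variable that satisfies `C`. -/
def Supports (φ : Assignment n) (x : Fin n) (C : Clause n) : Prop :=
  (x, φ x) ∈ C.1 ∧ ∀ l ∈ C.1, φ l.1 = l.2 → l.1 = x

/-- `F[A]`: the clauses of `F` all of whose variables belong to `A`. -/
def induced (F : Formula n) (A : Finset (Fin n)) : Formula n := F.filter fun C => vars C ⊆ A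

/-! ### Neighbourhoods of a variable, relative to the planted assignment

The literal of `x` that is true under `φ` is `(x, φ x)`, the one that is false is `(x, !φ x)`.
When `φ` is identically true these are the positive and the negative literal of `x`. -/

/-- `N^s(x)`: the clauses of `F` that `x` supports. -/
def Nsupp (φ : Assignment n) (F : Formula n) (x : Fin n) : Finset (Clause n) :=
  F.filter fun C => Supports φ x C

/-- `N^{++}(x)`: the clauses of `F` that contain the true literal of `x`
but are not supported by `x`. -/
def Npp (φ : Assignment n) (F : Formula n) (x : Fin n) : Finset (Clause n) :=
  F.filter fun C => (x, φ x) ∈ C.1 ∧ ¬ Supports φ x C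

/-- `N^-(x)`: the clauses of `F` that contain the false literal of `x`. -/
def Nneg (φ : Assignment n) (F : Formula n) (x : Fin n) : Finset (Clause n) :=
  F.filter fun C => (x, !φ x) ∈ C.1

/-! ### Clause-variable messages -/

/-- The edges of the factor graph of `F`; the pair `(C, x)` carries the message `C → x`. -/
def edges (F : Formula n) : Finset (Clause n × Fin n) :=
  Finset.univ.filter fun e => e.1 ∈ F ∧ e.2 ∈ vars e.1

/-- The type of clause-variable message edges of `F`. -/
abbrev Edge (F : Formula n) := {e : Clause n × Fin n // e ∈ edges F}

/-- A clause-variable message vector: a value `1` (`true`) or `0` (`false`) for every edge. -/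
abbrev Messages (F : Formula n) := Edge F → Bool

/-- An ordering of the clause-variable message edges: `π e` is the place of the edge `e`. -/
abbrev EdgeOrder (F : Formula n) := Edge F ≃ Fin (edges F).card

/-- `π^{-i}(l)`: the edges `C → x`, where `x` is the variable of `l`, that appear before place `i`
and in which `x` appears in `C` as `l`. -/
def before {F : Formula n} (π : EdgeOrder F) (i : Fin (edges F).card) (l : Literal n) :
    Finset (Edge F) :=
  Finset.univ.filter fun e => π e < i ∧ e.1.2 = l.1 ∧ l ∈ e.1.1.1

/-- The edges `C → y` with `C ∈ 𝒞`. -/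
def edgesInto (F : Formula n) (𝒞 : Finset (Clause n)) (y : Fin n) : Finset (Edge F) :=
  Finset.univ.filter fun e => e.1.1 ∈ 𝒞 ∧ e.1.2 = y

/-- `ℰ ∩ 𝒞`: the edges in `ℰ` whose clause belongs to `𝒞`. -/
def restrict {F : Formula n} (ℰ : Finset (Edge F)) (𝒞 : Finset (Clause n)) : Finset (Edge F) :=
  ℰ.filter fun e => e.1.1 ∈ 𝒞

/-- `1_α(ℰ)`: the edges in `ℰ` along which the value is `1`. -/
def ones {F : Formula n} (α : Messages F) (ℰ : Finset (Edge F)) : Finset (Edge F) :=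
  ℰ.filter fun e => α e = true

/-! ### Stable and violated variables -/

/-- The three requirements that stability of a neighbouring variable makes on `y` at place `i`. -/
def StableAt (d : ℝ) (φ : Assignment n) (F : Formula n) (π : EdgeOrder F)
    (i : Fin (edges F).card) (y : Fin n) : Prop :=
  |((restrict (before π i (y, φ y)) (Npp φ F y)).card : ℝ) -
      ((restrict (before π i (y, !φ y)) (Nneg φ F y)).card : ℝ)| ≤ d / 30 ∧
  |((Npp φ F y).card : ℝ) - ((Nneg φ F y).card : ℝ)| ≤ d / 30 ∧
  d / 3 ≤ ((Nsupp φ F y).card : ℝ)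

/-- `x` is stable in `F` with respect to the edge order `π`. -/
def Stable (d : ℝ) (φ : Assignment n) (F : Formula n) (π : EdgeOrder F) (x : Fin n) : Prop :=
  ∀ e : Edge F, e.1.2 = x → ∀ y ∈ vars e.1.1, y ≠ x → StableAt d φ F π (π e) y

/-- One of the three violations occurs for the variable `y` at place `i`. -/
def ViolatedAt (d : ℝ) (φ : Assignment n) (F : Formula n) (α : Messages F) (π : EdgeOrder F)
    (i : Fin (edges F).card) (y : Fin n) : Prop :=
  d / 30 < |((ones α (restrict (before π i (y, φ y)) (Npp φ F y))).card : ℝ) -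
      ((ones α (restrict (before π i (y, !φ y)) (Nneg φ F y))).card : ℝ)| ∨
  d / 30 < |((ones α (edgesInto F (Npp φ F y) y)).card : ℝ) -
      ((ones α (edgesInto F (Nneg φ F y) y)).card : ℝ)| ∨
  ((ones α (edgesInto F (Nsupp φ F y) y)).card : ℝ) < d / 7

/-- `x` is violated by `α` in `π`. -/
def Violated (d : ℝ) (φ : Assignment n) (F : Formula n) (α : Messages F) (π : EdgeOrder F)
    (x : Fin n) : Prop :=
  ∃ e : Edge F, e.1.2 = x ∧ ∃ y ∈ vars e.1.1, y ≠ x ∧ ViolatedAt d φ F α π (π e) y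

/-! ### The core -/

/-- `A₁`: the variables whose support is at most `d / 3`. -/
def lowSupport (d : ℝ) (φ : Assignment n) (F : Formula n) : Finset (Fin n) :=
  Finset.univ.filter fun x => ((Nsupp φ F x).card : ℝ) ≤ d / 3

/-- `A₂`: the variables that are not stable with respect to `π`. -/
def unstable (d : ℝ) (φ : Assignment n) (F : Formula n) (π : EdgeOrder F) : Finset (Fin n) :=
  Finset.univ.filter fun x => ¬ Stable d φ F π x

/-- `A₃`: the variables that are stable with respect to `π` and violated by `α`. -/
def stableViolated (d : ℝ) (φ : Assignment n) (F : Formula n) (α : Messages F)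
    (π : EdgeOrder F) : Finset (Fin n) :=
  Finset.univ.filter fun x => Stable d φ F π x ∧ Violated d φ F α π x

/-- The initial set `H₀ = V \ (A₁ ∪ A₂ ∪ A₃)` of the procedure. -/
def initialSet (d : ℝ) (φ : Assignment n) (F : Formula n) (α : Messages F)
    (π : EdgeOrder F) : Finset (Fin n) :=
  Finset.univ \ (lowSupport d φ F ∪ unstable d φ F π ∪ stableViolated d φ F α π)

/-- `a` may be removed from `H`: it supports less than `d / 4` clauses in `F[H]`, or it appears in
more than `d / 30` clauses of `F` that are not in `F[H]`. -/
def Removable (d : ℝ) (φ : Assignment n) (F : Formula n) (H : Finset (Fin n)) (a : Fin n) : Prop :=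
  (((induced F H).filter fun C => Supports φ a C).card : ℝ) < d / 4 ∨
  d / 30 < (((F \ induced F H).filter fun C => a ∈ vars C).card : ℝ)

/-- One step of the procedure: some removable variable of `H` is removed. -/
def RemovalStep (d : ℝ) (φ : Assignment n) (F : Formula n) (H H' : Finset (Fin n)) : Prop :=
  ∃ a ∈ H, Removable d φ F H a ∧ H' = H.erase a

/-- `H` is the set with which the procedure ends, for some order of the removals. -/
def IsCore (d : ℝ) (φ : Assignment n) (F : Formula n) (α : Messages F) (π : EdgeOrder F)
    (H : Finset (Fin n)) : Prop :=
  Relation.ReflTransGen (RemovalStep d φ F) (initialSet d φ F α π) H ∧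
  ∀ a ∈ H, ¬ Removable d φ F H a

/-- The procedure always ends, so that there is always a core. -/
theorem exists_isCore (d : ℝ) (φ : Assignment n) (F : Formula n) (α : Messages F)
    (π : EdgeOrder F) : ∃ H, IsCore d φ F α π H := by
  have key : ∀ (k : ℕ) (H : Finset (Fin n)), H.card = k →
      ∃ H', Relation.ReflTransGen (RemovalStep d φ F) H H' ∧ ∀ a ∈ H', ¬ Removable d φ F H' a := by
    intro k
    induction k with
    | zero =>
      intro H hH
      rw [Finset.card_eq_zero] at hH
      subst hH
      exact ⟨∅, Relation.ReflTransGen.refl, by simp⟩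
    | succ k ih =>
      intro H hH
      by_cases h : ∀ a ∈ H, ¬ Removable d φ F H a
      · exact ⟨H, Relation.ReflTransGen.refl, h⟩
      · push Not at h
        obtain ⟨a, ha, hr⟩ := h
        obtain ⟨H', h1, h2⟩ := ih (H.erase a) (by rw [Finset.card_erase_of_mem ha, hH]; rfl)
        exact ⟨H', Relation.ReflTransGen.head ⟨a, ha, hr, rfl⟩ h1, h2⟩
  exact key _ _ rfl

/-! ### The probability space -/

/-- The probability of the event `E` under the uniform distribution on a finite type `Ω`. -/
def uniformProb {Ω : Type} [Finite Ω] (E : Ω → Prop) : ℝ :=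
  (Nat.card {ω : Ω // E ω} : ℝ) / (Nat.card Ω : ℝ)

/-- The clauses satisfied by `φ`. -/
def satClauses (φ : Assignment n) : Finset (Clause n) :=
  Finset.univ.filter fun C => Satisfies φ C

/-- The probability that the planted formula with planted assignment `φ`, in which every clause
satisfied by `φ` is included independently with probability `p`, equals `F ⊆ satClauses φ`. -/
def plantedWeight (p : ℝ) (φ : Assignment n) (F : Formula n) : ℝ :=
  p ^ F.card * (1 - p) ^ ((satClauses φ).card - F.card)

/-- The probability of the event `E` when the planted assignment `φ` is uniformly random, `F` is
the random planted formula given `φ`, and, given `F`, the message vector `α` and the edge order `π`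
are independent and uniformly random. -/
def plantedProb (n : ℕ) (p : ℝ)
    (E : (φ : Assignment n) → (F : Formula n) → Messages F → EdgeOrder F → Prop) : ℝ :=
  ∑ φ : Assignment n, (Fintype.card (Assignment n) : ℝ)⁻¹ *
    ∑ F ∈ (satClauses φ).powerset, plantedWeight p φ F *
      uniformProb fun ω : Messages F × EdgeOrder F => E φ F ω.1 ω.2

end

end PlantedSAT

/-! Fix `φ` and put `c = 10⁻⁷`, `t = ⌊e^{-cd} n⌋ + 1` and `r = ⌊t / (2000 d)⌋ + 1`. The claim is
that fewer than `t` variables lie outside the core, up to probability `8 / n`.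

A variable outside the initial set is exceptional or shares a clause with an exceptional variable
(`compl_initialSet_subset`). Exceptional variables come in seven kinds: low support, too many
positive or too many negative occurrences, high degree, an unbalanced initial segment of the order,
unbalanced messages in an initial segment, and few supporting messages equal to `1`. For each kind,
the probability that all variables of a fixed `r`-set `T` are of that kind is at most `e^{-10⁻⁶ d
r}`, and this beats the number `n.choose r` of such sets. So each kind has fewer than `r` members.
Since every `r`-set has total degree below `20 d r`, the initial set misses at most `t / 2`
variables.

The joint bounds over `T` need different tools. For the formula, a clause has three variables, so a
sum over `T` of vertex statistics is a sum of bounded independent clause contributions and has an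
exponential moment bound (`formulaProb_sum_ge_le`). For the messages, edges into different variables
carry independent bits, so the failure probabilities multiply (`uniformProb_blocks_le`). The order
has no independence; it is produced by matching positive with negative edges into each variable and
exchanging matched partners by independent fair bits, which preserves the uniform law
(`uniformProb_order_excess_le`).

Finally, if the removals lost `t` variables in all, then at the moment when the complement `U` has
exactly `t` elements, at least `t / 2` of them have been removed, and each lies in at least `d / 30`
clauses meeting `U` twice. This forces `t d / 180` such clauses, many more than a random formula has
on any set of `t ≤ n / 6400` variables (`card_compl_lt_of_reflTransGen`, `formulaProb_dense_le`). -/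

namespace PlantedSAT

/-! ### The uniform distribution on a finite type -/

section Uniform

open scoped Classical

variable {Ω : Type} [Fintype Ω]

theorem uniformProb_eq_sum (E : Ω → Prop) :
    uniformProb E = (∑ ω, if E ω then (1 : ℝ) else 0) / Fintype.card Ω := by
  rw [uniformProb, Nat.card_eq_fintype_card, Nat.card_eq_fintype_card, Fintype.card_subtype,
    Finset.sum_boole]

theorem uniformProb_le_sum (E : Ω → Prop) (g : Ω → ℝ) (hg : ∀ ω, 0 ≤ g ω)
    (h : ∀ ω, E ω → 1 ≤ g ω) : uniformProb E ≤ (∑ ω, g ω) / Fintype.card Ω := by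
  rw [uniformProb_eq_sum]
  gcongr with ω
  split_ifs with hE
  exacts [h ω hE, hg ω]

theorem uniformProb_nonneg (E : Ω → Prop) : 0 ≤ uniformProb E := by
  unfold uniformProb; positivity

theorem uniformProb_le_one (E : Ω → Prop) : uniformProb E ≤ 1 := by
  refine (uniformProb_le_sum E (fun _ => 1) (by simp) (by simp)).trans ?_
  simpa using div_self_le_one _

theorem uniformProb_mono {E E' : Ω → Prop} (h : ∀ ω, E ω → E' ω) :
    uniformProb E ≤ uniformProb E' := by
  rw [uniformProb_eq_sum E']
  refine uniformProb_le_sum _ _ (fun ω => by positivity) fun ω hω => ?_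
  rw [if_pos (h ω hω)]

theorem uniformProb_or_le (E E' : Ω → Prop) :
    uniformProb (fun ω => E ω ∨ E' ω) ≤ uniformProb E + uniformProb E' := by
  rw [uniformProb_eq_sum E, uniformProb_eq_sum E', ← add_div, ← Finset.sum_add_distrib]
  refine uniformProb_le_sum _ _ (fun ω => by positivity) fun ω hω => ?_
  rcases hω with h | h
  · rw [if_pos h]; linarith [show (0 : ℝ) ≤ if E' ω then 1 else 0 by positivity]
  · rw [if_pos h]; linarith [show (0 : ℝ) ≤ if E ω then 1 else 0 by positivity]

theorem uniformProb_exists_le {ι : Type*} (s : Finset ι) (E : ι → Ω → Prop) :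
    uniformProb (fun ω => ∃ i ∈ s, E i ω) ≤ ∑ i ∈ s, uniformProb (E i) := by
  simp only [uniformProb_eq_sum (E _)]
  rw [← Finset.sum_div, Finset.sum_comm]
  refine uniformProb_le_sum _ _ (fun ω => by positivity) ?_
  rintro ω ⟨i, hi, h⟩
  refine le_trans ?_ (Finset.single_le_sum (f := fun i => if E i ω then (1 : ℝ) else 0)
    (fun _ _ => by positivity) hi)
  simp [h]

theorem one_sub_uniformProb_not_le [Nonempty Ω] (E : Ω → Prop) :
    1 - uniformProb (fun ω => ¬ E ω) ≤ uniformProb E := by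
  have h := uniformProb_or_le E fun ω => ¬ E ω
  have h1 : uniformProb (fun ω => E ω ∨ ¬ E ω) = 1 := by
    rw [uniformProb_eq_sum]
    simp [em]
  linarith

/-- If for every `ω` the average of the indicator of `E` over the points `T i ω` is at most `q`,
and each `T i` is a bijection, then `E` has probability at most `q`. -/
theorem uniformProb_le_of_equiv {I : Type} [Fintype I] [Nonempty I] (T : I → Ω ≃ Ω)
    (E : Ω → Prop) {q : ℝ} (hq : 0 ≤ q) (h : ∀ ω, uniformProb (fun i => E (T i ω)) ≤ q) :
    uniformProb E ≤ q := by
  rcases isEmpty_or_nonempty Ω with hΩ | hΩ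
  · simpa [uniformProb] using hq
  have hc : (0 : ℝ) < Fintype.card Ω := by exact_mod_cast Fintype.card_pos
  have hI : (0 : ℝ) < Fintype.card I := by exact_mod_cast Fintype.card_pos
  rw [uniformProb_eq_sum, div_le_iff₀ hc]
  have h1 : ∀ i, (∑ ω, if E (T i ω) then (1 : ℝ) else 0) = ∑ ω, if E ω then (1 : ℝ) else 0 :=
    fun i => Equiv.sum_comp (T i) fun ω => if E ω then (1 : ℝ) else 0
  have h2 : (Fintype.card I : ℝ) * (∑ ω, if E ω then (1 : ℝ) else 0)
      = ∑ ω, ∑ i, if E (T i ω) then (1 : ℝ) else 0 := by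
    rw [Finset.sum_comm]
    simp [h1]
  have h3 : (∑ ω, ∑ i, if E (T i ω) then (1 : ℝ) else 0) ≤ ∑ _ω : Ω, q * Fintype.card I := by
    refine Finset.sum_le_sum fun ω _ => ?_
    have := h ω
    rwa [uniformProb_eq_sum, div_le_iff₀ hI] at this
  rw [← h2] at h3
  simp only [Finset.sum_const, Finset.card_univ, nsmul_eq_mul] at h3
  nlinarith

theorem uniformProb_prod_le_of_fst {Ω' : Type} [Fintype Ω'] (E : Ω × Ω' → Prop) {q : ℝ}
    (hq : 0 ≤ q) (h : ∀ a, uniformProb (fun b => E (a, b)) ≤ q) : uniformProb E ≤ q := by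
  rcases isEmpty_or_nonempty Ω with hΩ | hΩ
  · simpa [uniformProb] using hq
  rcases isEmpty_or_nonempty Ω' with hΩ' | hΩ'
  · simpa [uniformProb] using hq
  have hc : (0 : ℝ) < Fintype.card Ω := by exact_mod_cast Fintype.card_pos
  have hc' : (0 : ℝ) < Fintype.card Ω' := by exact_mod_cast Fintype.card_pos
  rw [uniformProb_eq_sum, Fintype.card_prod, Nat.cast_mul, div_le_iff₀ (by positivity),
    Fintype.sum_prod_type]
  have : ∀ a, (∑ b, if E (a, b) then (1 : ℝ) else 0) ≤ q * Fintype.card Ω' := fun a => by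
    have := h a
    rwa [uniformProb_eq_sum, div_le_iff₀ hc'] at this
  refine (Finset.sum_le_sum fun a _ => this a).trans (le_of_eq ?_)
  simp only [Finset.sum_const, Finset.card_univ, nsmul_eq_mul]
  ring

theorem uniformProb_prod_le_of_snd {Ω' : Type} [Fintype Ω'] (E : Ω × Ω' → Prop) {q : ℝ}
    (hq : 0 ≤ q) (h : ∀ b, uniformProb (fun a => E (a, b)) ≤ q) : uniformProb E ≤ q := by
  have h1 := uniformProb_prod_le_of_fst (fun x : Ω' × Ω => E (x.2, x.1)) hq h
  refine le_of_eq_of_le ?_ h1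
  rw [uniformProb_eq_sum, uniformProb_eq_sum, Fintype.card_prod, Fintype.card_prod, mul_comm,
    ← Equiv.sum_comp (Equiv.prodComm Ω Ω')]
  rfl

end Uniform

/-! ### Sums of independent random signs -/

section Signs

open scoped Classical

/-- The sign encoded by a bit. -/
def sgn (b : Bool) : ℝ := if b then 1 else -1

variable {ι V Γ : Type} [Fintype ι] [Fintype V] [DecidableEq V]

/-- The exponential moment factors over the signs, and each factor is `cosh (a e) ≤ exp (a e ^ 2 /
2)`. -/
theorem sum_exp_sgn_le (a : ι → ℝ) :
    (∑ ε : ι → Bool, Real.exp (∑ e, a e * sgn (ε e))) / Fintype.card (ι → Bool)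
      ≤ Real.exp ((∑ e, a e ^ 2) / 2) := by
  rw [div_le_iff₀ (by exact_mod_cast Fintype.card_pos)]
  have h1 : (∑ ε : ι → Bool, Real.exp (∑ e, a e * sgn (ε e)))
      = ∏ e, ∑ b : Bool, Real.exp (a e * sgn b) := by
    rw [Finset.prod_univ_sum, Fintype.piFinset_univ]
    exact Finset.sum_congr rfl fun ε _ => Real.exp_sum _ _
  have h2 : ∀ e, ∑ b : Bool, Real.exp (a e * sgn b) ≤ Real.exp (a e ^ 2 / 2) * 2 := by
    intro e
    have := Real.cosh_le_exp_half_sq (a e)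
    rw [Real.cosh_eq] at this
    simp only [Fintype.sum_bool, sgn]
    simp
    linarith
  rw [h1]
  refine (Finset.prod_le_prod (fun _ _ => by positivity) fun e _ => h2 e).trans (le_of_eq ?_)
  rw [Finset.prod_mul_distrib, ← Real.exp_sum, Finset.sum_div]
  simp

theorem uniformProb_sgn_le (a : ι → ℝ) (τ : ℝ) :
    uniformProb (fun ε : ι → Bool => τ ≤ ∑ e, a e * sgn (ε e))
      ≤ Real.exp ((∑ e, a e ^ 2) / 2 - τ) := by
  refine (uniformProb_le_sum _ (fun ε => Real.exp (∑ e, a e * sgn (ε e)) * Real.exp (-τ))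
    (fun _ => by positivity) fun ε h => ?_).trans ?_
  · rw [← Real.exp_add]
    exact Real.one_le_exp (by linarith)
  · rw [← Finset.sum_mul, mul_div_right_comm, sub_eq_add_neg, Real.exp_add]
    gcongr
    exact sum_exp_sgn_le a

/-- Signs that are grouped into blocks: the probability that in each block `y ∈ T` one of the
linear forms `f y c`, `c ∈ I y`, is large. -/
theorem uniformProb_blocks_le (κ : ι → V) (T : Finset V) (I : V → Finset Γ)
    (f : V → Γ → ι → ℝ) (τ : V → Γ → ℝ) {q : ℝ}
    (hq : ∀ y ∈ T, ∑ c ∈ I y,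
      Real.exp ((∑ e with κ e = y, f y c e ^ 2) / 2 - τ y c) ≤ q) :
    uniformProb (fun ε : ι → Bool => ∀ y ∈ T, ∃ c ∈ I y,
      τ y c ≤ ∑ e with κ e = y, f y c e * sgn (ε e)) ≤ q ^ T.card := by
  rcases isEmpty_or_nonempty Γ with hΓ | ⟨⟨c₀⟩⟩
  · rcases T.eq_empty_or_nonempty with rfl | ⟨y, hy⟩
    · simpa using uniformProb_le_one _
    · refine (uniformProb_le_sum _ (fun _ => 0) (fun _ => le_rfl) fun ε h => ?_).trans ?_
      · obtain ⟨c, -⟩ := h y hy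
        exact hΓ.elim c
      · have : 0 ≤ q := le_trans (Finset.sum_nonneg fun _ _ => by positivity) (hq y hy)
        simpa using pow_nonneg this _
  -- Blocks outside `T` get the single dummy choice `c₀` of weight `1`, so that choice functions are
  -- defined on all of `V`.
  set J : V → Finset Γ := fun y => if y ∈ T then I y else {c₀}
  set g : V → Γ → ℝ := fun y c =>
    if y ∈ T then Real.exp ((∑ e with κ e = y, f y c e ^ 2) / 2 - τ y c) else 1
  -- Choosing one large form per block and adding them yields a single linear form in all signs that
  -- exceeds the sum of the thresholds.
  have hcov : ∀ ε : ι → Bool, (∀ y ∈ T, ∃ c ∈ I y,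
      τ y c ≤ ∑ e with κ e = y, f y c e * sgn (ε e)) →
      ∃ c ∈ Fintype.piFinset J, ∑ y ∈ T, τ y (c y) ≤
        ∑ e, (if κ e ∈ T then f (κ e) (c (κ e)) e else 0) * sgn (ε e) := by
    intro ε h
    have h' : ∀ y, ∃ c ∈ J y, y ∈ T → τ y c ≤ ∑ e with κ e = y, f y c e * sgn (ε e) := by
      intro y
      by_cases hy : y ∈ T
      · obtain ⟨c, hc, hc'⟩ := h y hy
        exact ⟨c, by simpa [J, hy] using hc, fun _ => hc'⟩
      · exact ⟨c₀, by simp [J, hy], fun h => absurd h hy⟩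
    choose c hc hc' using h'
    refine ⟨c, by simpa [Fintype.mem_piFinset] using hc, ?_⟩
    refine (Finset.sum_le_sum fun y hy => hc' y hy).trans (le_of_eq ?_)
    simp only [ite_mul, zero_mul]
    rw [← Finset.sum_filter, ← Finset.sum_fiberwise_of_maps_to (s := {e | κ e ∈ T}) (t := T)
      (g := κ) (by simp)]
    refine Finset.sum_congr rfl fun y hy => ?_
    rw [Finset.filter_filter]
    refine Finset.sum_congr ?_ ?_
    · ext e; simp; rintro rfl; exact hy
    · intro e he
      simp only [Finset.mem_filter] at he
      rw [he.2.2]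
  refine (uniformProb_mono hcov).trans ((uniformProb_exists_le _ _).trans ?_)
  have hterm : ∀ c : V → Γ, uniformProb (fun ε : ι → Bool => ∑ y ∈ T, τ y (c y) ≤
        ∑ e, (if κ e ∈ T then f (κ e) (c (κ e)) e else 0) * sgn (ε e)) ≤ ∏ y, g y (c y) := by
    intro c
    refine (uniformProb_sgn_le _ _).trans (le_of_eq ?_)
    rw [Finset.prod_ite_mem, Finset.univ_inter, ← Real.exp_sum, Finset.sum_sub_distrib,
      ← Finset.sum_div]
    congr 3
    simp only [ite_pow, ne_eq, OfNat.ofNat_ne_zero, not_false_eq_true, zero_pow]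
    rw [← Finset.sum_filter, ← Finset.sum_fiberwise_of_maps_to (s := {e | κ e ∈ T}) (t := T)
      (g := κ) (by simp)]
    refine Finset.sum_congr rfl fun y hy => ?_
    rw [Finset.filter_filter]
    refine Finset.sum_congr ?_ ?_
    · ext e; simp; rintro rfl; exact hy
    · intro e he
      simp only [Finset.mem_filter] at he
      rw [he.2]
  refine (Finset.sum_le_sum fun c _ => hterm c).trans ?_
  -- The union bound over choice functions turns back into a product over blocks by distributivity;
  -- this is where independence of the blocks enters.
  rw [← Finset.prod_univ_sum]
  have : ∀ y, ∑ c ∈ J y, g y c = if y ∈ T then ∑ c ∈ I y,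
      Real.exp ((∑ e with κ e = y, f y c e ^ 2) / 2 - τ y c) else 1 := by
    intro y
    by_cases hy : y ∈ T <;> simp [J, g, hy]
  simp only [this]
  rw [Finset.prod_ite_mem, Finset.univ_inter]
  refine (Finset.prod_le_prod (fun _ _ => Finset.sum_nonneg fun _ _ => by positivity) hq).trans ?_
  rw [Finset.prod_const]

end Signs

/-! ### Concentration for random orders and random bits, simultaneously over all initial segments -/

section Orders

open scoped Classical

variable {ι V : Type}

/-- Within each block, elements of sign `1` are matched with elements of sign `-1`, until one of
the two kinds is exhausted. -/
theorem exists_matching [Fintype ι] (κ : ι → V) (s : ι → ℝ) :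
    ∃ σ : Equiv.Perm ι, (∀ e, σ (σ e) = e) ∧ (∀ e, κ (σ e) = κ e) ∧
      (∀ e, σ e ≠ e → s (σ e) = -s e ∧ (s e = 1 ∨ s e = -1)) ∧
      ∀ e e', σ e = e → σ e' = e' → κ e = κ e' → s e = 1 → s e' = -1 → False := by
  -- Take an involution moving as many elements as possible: two fixed elements of opposite sign in
  -- one block could still be exchanged, contradicting maximality.
  obtain ⟨σ, ⟨h1, h2, h3⟩, hmax⟩ := Set.exists_max_image
    {σ : Equiv.Perm ι | (∀ e, σ (σ e) = e) ∧ (∀ e, κ (σ e) = κ e) ∧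
      (∀ e, σ e ≠ e → s (σ e) = -s e ∧ (s e = 1 ∨ s e = -1))}
    (fun σ => (Finset.univ.filter fun e => σ e ≠ e).card) (Set.toFinite _) ⟨1, by simp⟩
  refine ⟨σ, h1, h2, h3, fun e e' he he' hκ hs hs' => ?_⟩
  have hne : e ≠ e' := by rintro rfl; linarith
  have hσ : ∀ x, x ≠ e → x ≠ e' → (Equiv.swap e e' * σ) x = σ x := by
    intro x hx hx'
    refine Equiv.swap_apply_of_ne_of_ne (fun h => hx ?_) (fun h => hx' ?_)
    · exact σ.injective (h.trans he.symm)
    · exact σ.injective (h.trans he'.symm)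
  have hσe : (Equiv.swap e e' * σ) e = e' := by simp [he]
  have hσe' : (Equiv.swap e e' * σ) e' = e := by simp [he']
  have hmem : Equiv.swap e e' * σ ∈ {σ : Equiv.Perm ι | (∀ e, σ (σ e) = e) ∧
      (∀ e, κ (σ e) = κ e) ∧ (∀ e, σ e ≠ e → s (σ e) = -s e ∧ (s e = 1 ∨ s e = -1))} := by
    refine ⟨fun x => ?_, fun x => ?_, fun x => ?_⟩
    all_goals
      by_cases hx : x = e
      · subst hx; rw [hσe]; simp [hσe', hκ, hs, hs']
      by_cases hx' : x = e'
      · subst hx'; rw [hσe']; simp [hσe, hκ, hs, hs']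
      rw [hσ x hx hx']
    · rw [hσ, h1]
      · exact fun h => hx (by rw [← h1 x, h, he])
      · exact fun h => hx' (by rw [← h1 x, h, he'])
    · exact h2 x
    · exact h3 x
  have hlt : (Finset.univ.filter fun x => σ x ≠ x).card
      < (Finset.univ.filter fun x => (Equiv.swap e e' * σ) x ≠ x).card := by
    refine Finset.card_lt_card ⟨fun x hx => ?_, fun h => ?_⟩
    · simp only [Finset.mem_filter, Finset.mem_univ, true_and] at hx ⊢
      rwa [hσ x (fun h => hx (h ▸ he)) (fun h => hx (h ▸ he'))]
    · have := @h e (by rw [Finset.mem_filter, hσe]; exact ⟨Finset.mem_univ _, hne.symm⟩)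
      simp [he] at this
  exact absurd (hmax _ hmem) (not_le.2 hlt)

variable [DecidableEq V]

theorem abs_sum_mul_le {s u : ι → ℝ} (t : Finset ι) (hu : ∀ e, 0 ≤ u e ∧ u e ≤ 1)
    (hs : (∀ e ∈ t, 0 ≤ s e) ∨ ∀ e ∈ t, s e ≤ 0) : |∑ e ∈ t, s e * u e| ≤ |∑ e ∈ t, s e| := by
  rcases hs with hs | hs
  · rw [abs_of_nonneg (Finset.sum_nonneg fun e he => mul_nonneg (hs e he) (hu e).1),
      abs_of_nonneg (Finset.sum_nonneg hs)]
    exact Finset.sum_le_sum fun e he => mul_le_of_le_one_right (hs e he) (hu e).2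
  · rw [abs_of_nonpos (Finset.sum_nonpos fun e he => mul_nonpos_of_nonpos_of_nonneg (hs e he)
      (hu e).1), abs_of_nonpos (Finset.sum_nonpos hs)]
    refine neg_le_neg (Finset.sum_le_sum fun e he => ?_)
    nlinarith [hs e he, hu e]

/-- The elements of a block that stand before place `i` form an initial segment of the block. -/
theorem exists_last_before [Fintype ι] {m : ℕ} (κ : ι → V) (π : ι ≃ Fin m) (y : V) (i : ℕ) :
    (∀ e, κ e = y → ¬ (π e : ℕ) < i) ∨
      ∃ e', κ e' = y ∧ ∀ e, κ e = y → ((π e : ℕ) < i ↔ π e ≤ π e') := by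
  rcases (Finset.univ.filter fun e => κ e = y ∧ (π e : ℕ) < i).eq_empty_or_nonempty with h | h
  · left
    intro e he hi
    have : e ∈ Finset.univ.filter fun e => κ e = y ∧ (π e : ℕ) < i := by simp [he, hi]
    simp [h] at this
  · right
    obtain ⟨e', he', hmax⟩ := Finset.exists_max_image _ (fun e => π e) h
    simp only [Finset.mem_filter, Finset.mem_univ, true_and] at he' hmax
    refine ⟨e', he'.1, fun e he => ⟨fun hi => hmax e ⟨he, hi⟩, fun hle => ?_⟩⟩
    exact lt_of_le_of_lt (Fin.le_def.1 hle) he'.2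

/-- The partners under `σ` are exchanged where the bit of the partner of sign `1` is `false`. -/
noncomputable def swapBy (s : ι → ℝ) (σ : Equiv.Perm ι) (ε : ι → Bool) (e : ι) : ι :=
  if ε (if s e = 1 then e else σ e) then e else σ e

theorem swapBy_involutive {s : ι → ℝ} {σ : Equiv.Perm ι} (h1 : ∀ e, σ (σ e) = e)
    (h3 : ∀ e, σ e ≠ e → s (σ e) = -s e ∧ (s e = 1 ∨ s e = -1)) (ε : ι → Bool) :
    Function.Involutive (swapBy s σ ε) := by
  intro e
  by_cases he : σ e = e
  · simp [swapBy, he]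
  obtain ⟨h, h' | h'⟩ := h3 e he <;> rw [h'] at h
  · have h5 : ¬ (-1 : ℝ) = 1 := by norm_num
    by_cases hε : ε e <;> simp [swapBy, h, h', h1, hε, h5]
  · have h'' : ¬ s e = 1 := by rw [h']; norm_num
    have h4 : s (σ e) = 1 := by rw [h]; norm_num
    by_cases hε : ε (σ e) <;> simp [swapBy, h4, h'', h1, hε]

/-- Only the bit at the positive member of a pair matters: it decides whether the pair `e`, `σ e`
contributes `u e - u (σ e)` or its negative. Fixed elements contribute a constant. For fixed `u` the
block sum is thus a constant plus a sum of independent signs. -/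
theorem sum_mul_swapBy [Fintype ι] {κ : ι → V} {s : ι → ℝ} {σ : Equiv.Perm ι} (h1 : ∀ e, σ (σ e) = e)
    (h2 : ∀ e, κ (σ e) = κ e) (h3 : ∀ e, σ e ≠ e → s (σ e) = -s e ∧ (s e = 1 ∨ s e = -1))
    (ε : ι → Bool) (u : ι → ℝ) (y : V) :
    ∑ e with κ e = y, s e * u (swapBy s σ ε e)
      = ∑ e with κ e = y ∧ σ e = e, s e * u e
        + ∑ e with κ e = y, (if s e = 1 ∧ σ e ≠ e then u e - u (σ e) else 0) * sgn (ε e) := by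
  -- Reindexing by `σ` charges the term of each matched negative element to its positive partner.
  have hflip : (∑ e, if κ e = y ∧ σ e ≠ e ∧ s e ≠ 1 then s e * u (swapBy s σ ε e) else 0)
      = ∑ e, if κ e = y ∧ σ e ≠ e ∧ s e = 1 then -u (swapBy s σ ε (σ e)) else 0 := by
    rw [← Equiv.sum_comp σ]
    refine Finset.sum_congr rfl fun e _ => ?_
    rw [h1, h2]
    by_cases he : σ e = e
    · simp [he]
    obtain ⟨h, h' | h'⟩ := h3 e he <;> rw [h'] at h
    · have : ¬ e = σ e := fun h => he h.symm
      simp [he, h, h', this]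
      norm_num
    · have h4 : s (σ e) = 1 := by rw [h]; norm_num
      have h5 : ¬ (-1 : ℝ) = 1 := by norm_num
      simp [h4, h', h5]
  have hsplit : ∀ e, (if κ e = y then s e * u (swapBy s σ ε e) else 0)
      = (if κ e = y ∧ σ e = e then s e * u e else 0)
        + ((if κ e = y ∧ σ e ≠ e ∧ s e = 1 then s e * u (swapBy s σ ε e) else 0)
        + if κ e = y ∧ σ e ≠ e ∧ s e ≠ 1 then s e * u (swapBy s σ ε e) else 0) := by
    intro e
    by_cases hy : κ e = y <;> by_cases he : σ e = e <;> by_cases hs : s e = 1 <;>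
      simp [hy, he, hs, swapBy]
  simp only [Finset.sum_filter]
  rw [Finset.sum_congr rfl fun e _ => hsplit e, Finset.sum_add_distrib, Finset.sum_add_distrib,
    hflip, ← Finset.sum_add_distrib]
  congr 1
  refine Finset.sum_congr rfl fun e _ => ?_
  by_cases hy : κ e = y <;> by_cases he : σ e = e <;> by_cases hs : s e = 1 <;>
    simp [hy, he, hs]
  have h4 := (h3 e he).1
  have h5 : ¬ (-1 : ℝ) = 1 := by norm_num
  rw [hs] at h4
  by_cases hε : ε e <;> simp [swapBy, h4, hs, h5, h1, hε, sgn]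
  · ring
  · ring

/-- The excess of positive signs over negative signs among the elements of the block `y` that
stand before place `i` and along which `w` does not vanish. -/
noncomputable def excess [Fintype ι] {m : ℕ} (κ : ι → V) (s w : ι → ℝ) (π : ι → Fin m) (i : ℕ)
    (y : V) : ℝ :=
  ∑ e with κ e = y, s e * w e * if (π e : ℕ) < i then 1 else 0

variable [Fintype ι]

/-- A choice consists of the last element of an initial segment of the block and a sign for the
absolute value, whence the factor `2 * K`. -/
theorem sum_choices_exp_le {κ : ι → V} {y : V} {K l b : ℝ} {f : ι × Bool → ι → ℝ}
    (hK : ((Finset.univ.filter fun e => κ e = y).card : ℝ) ≤ K)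
    (hf : ∀ c e, f c e ^ 2 ≤ l ^ 2) :
    ∑ c ∈ (Finset.univ.filter fun e => κ e = y) ×ˢ (Finset.univ : Finset Bool),
      Real.exp ((∑ e with κ e = y, f c e ^ 2) / 2 - b) ≤ 2 * K * Real.exp (l ^ 2 * K / 2 - b) := by
  have h : ∀ c, ∑ e with κ e = y, f c e ^ 2 ≤ l ^ 2 * K := fun c => by
    refine (Finset.sum_le_sum fun e _ => hf c e).trans ?_
    rw [Finset.sum_const, nsmul_eq_mul, mul_comm]
    gcongr
  have h' : ∀ c ∈ (Finset.univ.filter fun e => κ e = y) ×ˢ (Finset.univ : Finset Bool),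
      Real.exp ((∑ e with κ e = y, f c e ^ 2) / 2 - b) ≤ Real.exp (l ^ 2 * K / 2 - b) := by
    intro c _
    have := h c
    gcongr
  refine (Finset.sum_le_sum h').trans ?_
  rw [Finset.sum_const, nsmul_eq_mul, Finset.card_product]
  gcongr
  simp only [Finset.card_univ, Fintype.card_bool]
  push_cast
  linarith

theorem exists_sgn_mul_of_lt_abs {x D l : ℝ} (hl : 0 ≤ l) (h : D ≤ |x|) :
    ∃ b : Bool, l * D ≤ l * sgn b * x := by
  rcases le_total 0 x with hx | hx
  · refine ⟨true, ?_⟩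
    rw [abs_of_nonneg hx] at h
    simpa [sgn] using mul_le_mul_of_nonneg_left h hl
  · refine ⟨false, ?_⟩
    rw [abs_of_nonpos hx] at h
    simpa [sgn] using mul_le_mul_of_nonneg_left h hl

/-- The probability that, in a uniformly random order, for all blocks in `T` some initial segment
has a large excess. -/
theorem uniformProb_order_excess_le [Fintype V] {m : ℕ} (κ : ι → V) (s : ι → ℝ)
    (hs : ∀ e, s e = 1 ∨ s e = -1 ∨ s e = 0) (T : Finset V) {K D₀ D l : ℝ} (hl : 0 ≤ l)
    (hK : 0 ≤ K) (hD : 0 ≤ D)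
    (hdeg : ∀ y ∈ T, ((Finset.univ.filter fun e => κ e = y).card : ℝ) ≤ K)
    (hbal : ∀ y ∈ T, |∑ e with κ e = y, s e| ≤ D₀) :
    uniformProb (fun π : ι ≃ Fin m => ∀ y ∈ T, ∃ i : ℕ, D < |excess κ s 1 π i y|)
      ≤ (2 * K * Real.exp (l ^ 2 * K / 2 - l * (D - D₀))) ^ T.card := by
  obtain ⟨σ, h1, h2, h3, h4⟩ := exists_matching κ s
  let S : (ι → Bool) → (ι ≃ Fin m) ≃ (ι ≃ Fin m) := fun ε =>
    -- For each `ε`, exchanging partners is a bijection of the set of orders, so it suffices to fix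
    -- `π` and bound the probability over `ε`.
    Equiv.equivCongr ((swapBy_involutive h1 h3 ε).toPerm) (Equiv.refl _)
  refine uniformProb_le_of_equiv S _ (by positivity) fun π => ?_
  let f : V → ι × Bool → ι → ℝ := fun _ c e => l * sgn c.2 *
    if s e = 1 ∧ σ e ≠ e then
      (if π e ≤ π c.1 then 1 else 0) - (if π (σ e) ≤ π c.1 then 1 else 0) else 0
  refine (uniformProb_mono ?_).trans (uniformProb_blocks_le κ T
    (fun y => (Finset.univ.filter fun e => κ e = y) ×ˢ (Finset.univ : Finset Bool)) f
    (fun _ _ => l * (D - D₀)) fun y hy => sum_choices_exp_le (hdeg y hy) fun c e => ?_)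
  · intro ε h y hy
    obtain ⟨i, hi⟩ := h y hy
    have hS : ∀ e, S ε π e = π (swapBy s σ ε e) := fun e => by
      simp only [S, Equiv.equivCongr_apply_apply]
      rfl
    have hex : excess κ s 1 (S ε π) i y = ∑ e with κ e = y, s e *
        (fun e => if (π e : ℕ) < i then (1 : ℝ) else 0) (swapBy s σ ε e) := by
      simp [excess, hS]
    rw [hex, sum_mul_swapBy h1 h2 h3 ε (fun e => if (π e : ℕ) < i then (1 : ℝ) else 0) y] at hi
    -- The unmatched elements of a block all have one sign, so a partial sum over them is no larger
    -- than the full sum.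
    have hR : |∑ e with κ e = y ∧ σ e = e, s e * (if (π e : ℕ) < i then (1 : ℝ) else 0)|
        ≤ D₀ := by
      refine (abs_sum_mul_le _ (fun e => by split_ifs <;> simp) ?_).trans ?_
      · by_cases hp : ∃ e, κ e = y ∧ σ e = e ∧ s e = 1
        · obtain ⟨e, he, he', hse⟩ := hp
          left
          intro x hx
          simp only [Finset.mem_filter, Finset.mem_univ, true_and] at hx
          rcases hs x with h | h | h
          · simp [h]
          · exact (h4 e x he' hx.2 (he.trans hx.1.symm) hse h).elim
          · simp [h]
        · push Not at hp
          right
          intro x hx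
          simp only [Finset.mem_filter, Finset.mem_univ, true_and] at hx
          rcases hs x with h | h | h
          · exact (hp x hx.1 hx.2 h).elim
          · simp [h]
          · simp [h]
      -- With constant weights the pairs cancel, so the unmatched elements carry the whole imbalance
      -- of the block, at most `D₀`.
      · have := sum_mul_swapBy h1 h2 h3 ε (fun _ => 1) y
        simp only [mul_one, sub_self, ite_self, zero_mul, Finset.sum_const_zero, add_zero] at this
        rw [← this]
        exact hbal y hy
    set X := ∑ e with κ e = y, (if s e = 1 ∧ σ e ≠ e then
      (if (π e : ℕ) < i then (1 : ℝ) else 0) - (if (π (σ e) : ℕ) < i then (1 : ℝ) else 0)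
      else 0) * sgn (ε e) with hX
    have hXD : D - D₀ ≤ |X| := by
      have := abs_add_le (∑ e with κ e = y ∧ σ e = e,
        s e * (if (π e : ℕ) < i then (1 : ℝ) else 0)) X
      linarith
    -- An empty initial segment has no excess. Any other is determined by its last element `e'`,
    -- which reduces the infinitely many places `i` to the finitely many choices of `f`.
    rcases exists_last_before κ π y i with hi' | ⟨e', he', hlast⟩
    · exfalso
      have hX0 : X = 0 := by
        refine Finset.sum_eq_zero fun e he => ?_
        simp only [Finset.mem_filter, Finset.mem_univ, true_and] at he
        simp [hi' e he, hi' (σ e) ((h2 e).trans he)]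
      have hR0 : ∑ e with κ e = y ∧ σ e = e, s e * (if (π e : ℕ) < i then (1 : ℝ) else 0) = 0 := by
        refine Finset.sum_eq_zero fun e he => ?_
        simp only [Finset.mem_filter, Finset.mem_univ, true_and] at he
        simp [hi' e he.1]
      have hi2 : D < |(∑ e with κ e = y ∧ σ e = e,
        s e * (if (π e : ℕ) < i then (1 : ℝ) else 0)) + X| := hi
      rw [hX0, hR0] at hi2
      simp at hi2
      linarith
    · obtain ⟨b, hb⟩ := exists_sgn_mul_of_lt_abs hl hXD
      refine ⟨(e', b), by simp [he'], hb.trans (le_of_eq ?_)⟩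
      rw [hX, Finset.mul_sum]
      refine Finset.sum_congr rfl fun e he => ?_
      simp only [Finset.mem_filter, Finset.mem_univ, true_and] at he
      simp only [f, hlast e he, hlast (σ e) ((h2 e).trans he)]
      ring
  · have : sgn c.2 ^ 2 = 1 := by cases c.2 <;> simp [sgn]
    simp only [f]
    rw [mul_pow, mul_pow, this, mul_one]
    refine mul_le_of_le_one_right (sq_nonneg _) ?_
    split_ifs <;> norm_num

/-- The value of a bit as a real number. -/
def bit (b : Bool) : ℝ := if b then 1 else 0

theorem bit_eq (b : Bool) : bit b = (1 + sgn b) / 2 := by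
  cases b <;> simp [bit, sgn]

/-- The probability that, for uniformly random bits, for all blocks in `T` some initial segment
has a large excess. -/
theorem uniformProb_bits_excess_le [Fintype V] {m : ℕ} (κ : ι → V) (s : ι → ℝ)
    (hs : ∀ e, |s e| ≤ 1) (T : Finset V) (π : ι ≃ Fin m) {K D l : ℝ} (hl : 0 ≤ l)
    (hD : 0 ≤ D)
    (hdeg : ∀ y ∈ T, ((Finset.univ.filter fun e => κ e = y).card : ℝ) ≤ K)
    (hbal : ∀ y ∈ T, ∀ i : ℕ, |excess κ s 1 π i y| ≤ D) :
    uniformProb (fun α : ι → Bool => ∀ y ∈ T, ∃ i : ℕ, D < |excess κ s (fun e => bit (α e)) π i y|)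
      ≤ (2 * K * Real.exp (l ^ 2 * K / 2 - l * D)) ^ T.card := by
  let f : V → ι × Bool → ι → ℝ := fun _ c e => l * sgn c.2 *
    (s e * (if π e ≤ π c.1 then 1 else 0))
  refine (uniformProb_mono ?_).trans (uniformProb_blocks_le κ T
    (fun y => (Finset.univ.filter fun e => κ e = y) ×ˢ (Finset.univ : Finset Bool)) f
    (fun _ _ => l * D) fun y hy => sum_choices_exp_le (hdeg y hy) fun c e => ?_)
  · intro α h y hy
    obtain ⟨i, hi⟩ := h y hy
    set X := ∑ e with κ e = y, s e * (if (π e : ℕ) < i then (1 : ℝ) else 0) * sgn (α e) with hX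
    -- Since `bit = (1 + sgn) / 2`, the excess of the ones is the mean of the full excess and a
    -- random sign sum. With the former at most `D`, the latter must reach `D`, so the same
    -- threshold serves for order and messages.
    have hex : excess κ s (fun e => bit (α e)) π i y = (excess κ s 1 π i y + X) / 2 := by
      simp only [excess, hX, bit_eq]
      rw [← Finset.sum_add_distrib, Finset.sum_div]
      refine Finset.sum_congr rfl fun e _ => ?_
      simp only [Pi.one_apply]
      ring
    have hXD : D ≤ |X| := by
      have h1 := abs_add_le (excess κ s 1 π i y) X
      have h2 := hbal y hy i
      rw [hex, abs_div, abs_two] at hi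
      linarith
    rcases exists_last_before κ π y i with hi' | ⟨e', he', hlast⟩
    · exfalso
      have hX0 : excess κ s (fun e => bit (α e)) π i y = 0 := by
        refine Finset.sum_eq_zero fun e he => ?_
        simp only [Finset.mem_filter, Finset.mem_univ, true_and] at he
        simp [hi' e he]
      rw [hX0, abs_zero] at hi
      linarith
    · obtain ⟨b, hb⟩ := exists_sgn_mul_of_lt_abs hl hXD
      refine ⟨(e', b), by simp [he'], hb.trans (le_of_eq ?_)⟩
      rw [hX, Finset.mul_sum]
      refine Finset.sum_congr rfl fun e he => ?_
      simp only [Finset.mem_filter, Finset.mem_univ, true_and] at he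
      simp only [f, hlast e he]
      ring
  · have : sgn c.2 ^ 2 = 1 := by cases c.2 <;> simp [sgn]
    simp only [f]
    rw [mul_pow, mul_pow, this, mul_one]
    refine mul_le_of_le_one_right (sq_nonneg _) ?_
    have := (sq_le_one_iff_abs_le_one _).2 (hs e)
    split_ifs <;> simp [this]

/-- The probability that, for uniformly random bits, for all blocks in `T` few of the at least
`W` bits selected by `w` are `true`. -/
theorem uniformProb_bits_low_le [Fintype V] (κ : ι → V) (w : ι → ℝ) (hw : ∀ e, w e = 0 ∨ w e = 1)
    (T : Finset V) {W D l : ℝ} (hl : 0 ≤ l) (hl' : l ≤ 1)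
    (hW : ∀ y ∈ T, W ≤ ∑ e with κ e = y, w e) :
    uniformProb (fun α : ι → Bool => ∀ y ∈ T, ∑ e with κ e = y, w e * bit (α e) < D)
      ≤ (Real.exp (l * (2 * D) - l * (1 - l / 2) * W)) ^ T.card := by
  refine (uniformProb_mono ?_).trans (uniformProb_blocks_le κ T
    (fun _ => (Finset.univ : Finset Unit)) (fun _ _ e => -l * w e)
    (fun y _ => l * (∑ e with κ e = y, w e) - l * (2 * D)) fun y hy => ?_)
  · intro α h y hy
    refine ⟨(), by simp, ?_⟩
    have h1 := h y hy
    have h2 : ∑ e with κ e = y, w e * bit (α e)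
        = ((∑ e with κ e = y, w e) + ∑ e with κ e = y, w e * sgn (α e)) / 2 := by
      rw [← Finset.sum_add_distrib, Finset.sum_div]
      refine Finset.sum_congr rfl fun e _ => ?_
      rw [bit_eq]
      ring
    simp only [mul_assoc]
    rw [← Finset.mul_sum]
    nlinarith
  · rw [Finset.univ_unique, Finset.sum_singleton]
    refine Real.exp_le_exp.2 ?_
    have h1 : ∑ e with κ e = y, (-l * w e) ^ 2 = l ^ 2 * ∑ e with κ e = y, w e := by
      rw [Finset.mul_sum]
      refine Finset.sum_congr rfl fun e _ => ?_
      rcases hw e with h | h <;> simp [h]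
    -- The weights are `0` or `1`, so the variance equals their sum `S` and the exponent is `l * (2
    -- * D) - l * (1 - l / 2) * S`, which decreases in `S`; hence `S` may be replaced by its lower
    -- bound `W`.
    rw [h1]
    have h2 := hW y hy
    have h3 : 0 ≤ l * (1 - l / 2) := by nlinarith
    nlinarith

end Orders

/-! ### Counting clauses -/

section Clauses

open scoped Classical

variable {n : ℕ}

theorem mem_vars {C : Clause n} {x : Fin n} : x ∈ vars C ↔ ∃ b, (x, b) ∈ C.1 := by
  simp [vars]

theorem card_vars (C : Clause n) : (vars C).card = 3 := C.2.2

theorem literal_unique {C : Clause n} {x : Fin n} {b b' : Bool} (h : (x, b) ∈ C.1)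
    (h' : (x, b') ∈ C.1) : b = b' := by
  have hinj : Set.InjOn Prod.fst (C.1 : Set (Literal n)) :=
    Finset.card_image_iff.1 (C.2.2.trans C.2.1.symm)
  have := hinj h h' rfl
  exact congrArg Prod.snd this

theorem Supports.mem_vars {φ : Assignment n} {x : Fin n} {C : Clause n} (h : Supports φ x C) :
    x ∈ vars C := PlantedSAT.mem_vars.2 ⟨_, h.1⟩

theorem Supports.unique {φ : Assignment n} {x y : Fin n} {C : Clause n} (h : Supports φ x C)
    (h' : Supports φ y C) : x = y := h'.2 _ h.1 rfl

/-- Negate the literals of the variable `y`. -/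
def flipLiteral (y : Fin n) (l : Literal n) : Literal n := (l.1, if l.1 = y then !l.2 else l.2)

theorem flipLiteral_involutive (y : Fin n) : Function.Involutive (flipLiteral y) := by
  rintro ⟨x, b⟩
  by_cases h : x = y <;> simp [flipLiteral, h]

/-- Negate the literal of the variable `y` in a clause. -/
def flipClause (y : Fin n) (C : Clause n) : Clause n :=
  ⟨C.1.image (flipLiteral y), by
    rw [Finset.card_image_of_injective _ (flipLiteral_involutive y).injective, Finset.image_image]
    exact C.2⟩

theorem mem_flipClause {y : Fin n} {C : Clause n} {l : Literal n} :
    l ∈ (flipClause y C).1 ↔ flipLiteral y l ∈ C.1 := by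
  simp only [flipClause, Finset.mem_image]
  constructor
  · rintro ⟨l', hl', rfl⟩
    rwa [flipLiteral_involutive]
  · exact fun h => ⟨_, h, flipLiteral_involutive y l⟩

theorem flipClause_involutive (y : Fin n) : Function.Involutive (flipClause y) := by
  intro C
  ext l
  rw [mem_flipClause, mem_flipClause, flipLiteral_involutive]

/-- Negating the literal of `y` exchanges the two sets: in both of them some other variable
satisfies the clause, so the clause stays satisfied. Consequently the expected imbalance at every
variable is exactly zero. -/
theorem card_Npp_satClauses (φ : Assignment n) (y : Fin n) :
    (Npp φ (satClauses φ) y).card = (Nneg φ (satClauses φ) y).card := by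
  refine Finset.card_nbij' (flipClause y) (flipClause y) ?_ ?_
    (fun C _ => flipClause_involutive y C) (fun C _ => flipClause_involutive y C)
  · intro C hC
    simp only [Npp, Nneg, satClauses, Finset.coe_filter, Finset.mem_filter, Finset.mem_univ,
      true_and, Set.mem_ofPred_eq] at hC ⊢
    obtain ⟨-, hy, hs⟩ := hC
    simp only [Supports, not_and, not_forall] at hs
    obtain ⟨l, hl, hφ, hne⟩ := hs hy
    refine ⟨⟨l, mem_flipClause.2 ?_, hφ⟩, mem_flipClause.2 ?_⟩
    · simpa [flipLiteral, hne] using hl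
    · simpa [flipLiteral] using hy
  · intro C hC
    simp only [Npp, Nneg, satClauses, Finset.coe_filter, Finset.mem_filter, Finset.mem_univ,
      true_and, Set.mem_ofPred_eq] at hC ⊢
    obtain ⟨⟨l, hl, hφ⟩, hy⟩ := hC
    have hne : l.1 ≠ y := by
      rintro rfl
      have := literal_unique (b := l.2) hl hy
      simp [hφ] at this
    have hl' : l ∈ (flipClause y C).1 := mem_flipClause.2 (by simpa [flipLiteral, hne] using hl)
    exact ⟨⟨l, hl', hφ⟩, mem_flipClause.2 (by simpa [flipLiteral] using hy),
      fun h => hne (h.2 l hl' hφ)⟩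

/-- Any two further variables, both taken with their false literals, give a clause supported by `y`.
The expected support is therefore about `d / 2`, well above `d / 3`. -/
theorem choose_le_card_Nsupp_satClauses (φ : Assignment n) (y : Fin n) :
    (n - 1).choose 2 ≤ (Nsupp φ (satClauses φ) y).card := by
  have h1 : (n - 1).choose 2 = (Finset.powersetCard 2 (Finset.univ.erase y)).card := by
    rw [Finset.card_powersetCard, Finset.card_erase_of_mem (Finset.mem_univ _), Finset.card_univ,
      Fintype.card_fin]
  rw [h1]
  refine Finset.card_le_card_of_surjOn (fun C => (vars C).erase y) ?_
  intro P hP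
  rw [Finset.mem_coe, Finset.mem_powersetCard, Finset.subset_erase] at hP
  obtain ⟨⟨-, hy⟩, hP2⟩ := hP
  let g : Fin n → Literal n := fun x => (x, if x = y then φ x else !φ x)
  have hg : Function.Injective g := fun a b h => congrArg Prod.fst h
  have him : ((insert y P).image g).image Prod.fst = insert y P := by
    rw [Finset.image_image]
    exact Finset.image_id
  have hc : (insert y P).card = 3 := by rw [Finset.card_insert_of_notMem hy, hP2]
  have hyC : (y, φ y) ∈ (insert y P).image g :=
    Finset.mem_image.2 ⟨y, Finset.mem_insert_self _ _, by simp [g]⟩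
  refine ⟨⟨(insert y P).image g, by rw [Finset.card_image_of_injective _ hg, hc],
    by rw [him, hc]⟩, ?_, ?_⟩
  · simp only [Nsupp, satClauses, Finset.coe_filter, Finset.mem_filter, Finset.mem_univ,
      true_and, Set.mem_ofPred_eq]
    refine ⟨⟨_, hyC, rfl⟩, hyC, ?_⟩
    rintro l hl hφ
    obtain ⟨x, -, rfl⟩ := Finset.mem_image.1 hl
    by_contra hne
    simp only [g] at hne hφ
    simp [hne] at hφ
  · simp only [vars, him]
    exact Finset.erase_insert hy

theorem card_clauses_mem_vars_le (y : Fin n) :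
    (Finset.univ.filter fun C : Clause n => y ∈ vars C).card ≤ 8 * n ^ 2 := by
  have h : ((Finset.univ.filter fun C : Clause n => y ∈ vars C).image Subtype.val).card
      ≤ (Finset.univ : Finset (Bool × Literal n × Literal n)).card := by
    refine Finset.card_le_card_of_surjOn (fun a => {(y, a.1), a.2.1, a.2.2}) ?_
    intro A hA
    simp only [Finset.coe_image, Set.mem_image, Finset.mem_coe, Finset.mem_filter] at hA
    obtain ⟨C, ⟨-, hC⟩, rfl⟩ := hA
    obtain ⟨b, hb⟩ := mem_vars.1 hC
    obtain ⟨l, l', -, hl⟩ := Finset.card_eq_two.1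
      (show (C.1.erase (y, b)).card = 2 by rw [Finset.card_erase_of_mem hb, C.2.1])
    exact ⟨(b, l, l'), by simp, by rw [← Finset.insert_erase hb, hl]⟩
  rw [Finset.card_image_of_injective _ Subtype.val_injective] at h
  refine h.trans (le_of_eq ?_)
  simp
  ring

theorem card_clauses_mem_vars_mem_vars_le {u v : Fin n} (huv : u ≠ v) :
    (Finset.univ.filter fun C : Clause n => u ∈ vars C ∧ v ∈ vars C).card ≤ 8 * n := by
  have h : ((Finset.univ.filter fun C : Clause n => u ∈ vars C ∧ v ∈ vars C).image
      Subtype.val).card ≤ (Finset.univ : Finset (Bool × Bool × Literal n)).card := by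
    refine Finset.card_le_card_of_surjOn (fun a => {(u, a.1), (v, a.2.1), a.2.2}) ?_
    intro A hA
    simp only [Finset.coe_image, Set.mem_image, Finset.mem_coe, Finset.mem_filter] at hA
    obtain ⟨C, ⟨-, hu, hv⟩, rfl⟩ := hA
    obtain ⟨b, hb⟩ := mem_vars.1 hu
    obtain ⟨b', hb'⟩ := mem_vars.1 hv
    have hb'' : (v, b') ∈ C.1.erase (u, b) := Finset.mem_erase.2 ⟨by simp [huv.symm], hb'⟩
    obtain ⟨l, hl⟩ := Finset.card_eq_one.1
      (show ((C.1.erase (u, b)).erase (v, b')).card = 1 by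
        rw [Finset.card_erase_of_mem hb'', Finset.card_erase_of_mem hb, C.2.1])
    exact ⟨(b, b', l), by simp,
      by rw [← Finset.insert_erase hb, ← Finset.insert_erase hb'', hl]⟩
  rw [Finset.card_image_of_injective _ Subtype.val_injective] at h
  refine h.trans (le_of_eq ?_)
  simp
  ring

theorem card_clauses_two_vars_le (U : Finset (Fin n)) :
    (Finset.univ.filter fun C : Clause n => 2 ≤ (vars C ∩ U).card).card
      ≤ U.card ^ 2 * (8 * n) := by
  have hsub : (Finset.univ.filter fun C : Clause n => 2 ≤ (vars C ∩ U).card) ⊆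
      U.offDiag.biUnion fun q =>
        Finset.univ.filter fun C : Clause n => q.1 ∈ vars C ∧ q.2 ∈ vars C := by
    intro C hC
    simp only [Finset.mem_filter, Finset.mem_univ, true_and] at hC
    obtain ⟨u, hu, v, hv, huv⟩ := Finset.one_lt_card.1 (Nat.lt_of_succ_le hC)
    rw [Finset.mem_inter] at hu hv
    simp only [Finset.mem_biUnion, Finset.mem_offDiag, Finset.mem_filter, Finset.mem_univ,
      true_and]
    exact ⟨(u, v), ⟨hu.2, hv.2, huv⟩, hu.1, hv.1⟩
  refine (Finset.card_le_card hsub).trans ((Finset.card_biUnion_le_card_mul _ _ (8 * n)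
    fun q hq => card_clauses_mem_vars_mem_vars_le (Finset.mem_offDiag.1 hq).2.2).trans ?_)
  gcongr
  rw [Finset.offDiag_card, sq]
  exact Nat.sub_le _ _

end Clauses

/-! ### Chernoff bounds for the planted formula -/

section Planted

open scoped Classical

variable {n : ℕ}

/-- The probability of the event `E` for the planted formula with planted assignment `φ`. -/
noncomputable def formulaProb (p : ℝ) (φ : Assignment n) (E : Formula n → Prop) : ℝ :=
  ∑ F ∈ (satClauses φ).powerset, plantedWeight p φ F * if E F then 1 else 0

variable {p : ℝ} {φ : Assignment n}

theorem plantedWeight_nonneg (h0 : 0 ≤ p) (h1 : p ≤ 1) (F : Formula n) :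
    0 ≤ plantedWeight p φ F :=
  mul_nonneg (pow_nonneg h0 _) (pow_nonneg (by linarith) _)

theorem sum_plantedWeight_mul_prod (g : Clause n → ℝ) :
    ∑ F ∈ (satClauses φ).powerset, plantedWeight p φ F * ∏ C ∈ F, g C
      = ∏ C ∈ satClauses φ, (p * g C + (1 - p)) := by
  rw [Finset.prod_add]
  refine Finset.sum_congr rfl fun F hF => ?_
  rw [Finset.prod_mul_distrib, Finset.prod_const, Finset.prod_const, plantedWeight,
    Finset.card_sdiff_of_subset (Finset.mem_powerset.1 hF)]
  ring

theorem sum_plantedWeight : ∑ F ∈ (satClauses φ).powerset, plantedWeight p φ F = 1 := by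
  have := sum_plantedWeight_mul_prod (p := p) (φ := φ) fun _ => 1
  simpa using this

theorem formulaProb_mono (h0 : 0 ≤ p) (h1 : p ≤ 1) {E E' : Formula n → Prop}
    (h : ∀ F, E F → E' F) : formulaProb p φ E ≤ formulaProb p φ E' := by
  refine Finset.sum_le_sum fun F _ => mul_le_mul_of_nonneg_left ?_ (plantedWeight_nonneg h0 h1 F)
  by_cases hE : E F
  · simp [hE, h F hE]
  · simp only [hE, if_false]; positivity

theorem formulaProb_or_le (h0 : 0 ≤ p) (h1 : p ≤ 1) (E E' : Formula n → Prop) :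
    formulaProb p φ (fun F => E F ∨ E' F) ≤ formulaProb p φ E + formulaProb p φ E' := by
  rw [formulaProb, formulaProb, formulaProb, ← Finset.sum_add_distrib]
  refine Finset.sum_le_sum fun F _ => ?_
  rw [← mul_add]
  refine mul_le_mul_of_nonneg_left ?_ (plantedWeight_nonneg h0 h1 F)
  by_cases hE : E F <;> by_cases hE' : E' F <;> simp [hE, hE']

theorem formulaProb_exists_le (h0 : 0 ≤ p) (h1 : p ≤ 1) {ι : Type*} (s : Finset ι)
    (E : ι → Formula n → Prop) :
    formulaProb p φ (fun F => ∃ i ∈ s, E i F) ≤ ∑ i ∈ s, formulaProb p φ (E i) := by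
  simp only [formulaProb]
  rw [Finset.sum_comm]
  refine Finset.sum_le_sum fun F _ => ?_
  rw [← Finset.mul_sum]
  refine mul_le_mul_of_nonneg_left ?_ (plantedWeight_nonneg h0 h1 F)
  split_ifs with h
  · obtain ⟨i, hi, hE⟩ := h
    refine le_trans ?_ (Finset.single_le_sum (f := fun i => if E i F then (1 : ℝ) else 0)
      (fun _ _ => by positivity) hi)
    simp [hE]
  · positivity

/-- Exponential Markov inequality: each clause contributes the factor `1 + p (e^b - 1)`, and `e^b ≤
1 + b + b²` for `|b| ≤ 1`. -/
theorem formulaProb_sum_ge_le (h0 : 0 ≤ p) (h1 : p ≤ 1) (b : Clause n → ℝ)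
    (hb : ∀ C, |b C| ≤ 1) (τ : ℝ) :
    formulaProb p φ (fun F => τ ≤ ∑ C ∈ F, b C)
      ≤ Real.exp (p * ∑ C ∈ satClauses φ, (b C + b C ^ 2) - τ) := by
  have hle : formulaProb p φ (fun F => τ ≤ ∑ C ∈ F, b C)
      ≤ ∑ F ∈ (satClauses φ).powerset,
        (plantedWeight p φ F * ∏ C ∈ F, Real.exp (b C)) * Real.exp (-τ) := by
    refine Finset.sum_le_sum fun F _ => ?_
    rw [mul_assoc]
    refine mul_le_mul_of_nonneg_left ?_ (plantedWeight_nonneg h0 h1 F)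
    rw [← Real.exp_sum, ← Real.exp_add]
    split_ifs with h
    · exact Real.one_le_exp (by linarith)
    · positivity
  refine hle.trans ?_
  rw [← Finset.sum_mul, sum_plantedWeight_mul_prod, sub_eq_add_neg (p * _), Real.exp_add,
    Finset.mul_sum, Real.exp_sum]
  refine mul_le_mul_of_nonneg_right (Finset.prod_le_prod (fun C _ => ?_) fun C _ => ?_)
    (Real.exp_pos _).le
  · have := Real.exp_pos (b C)
    nlinarith
  · have h2 := (abs_le.1 (Real.abs_exp_sub_one_sub_id_le (hb C))).2
    have h3 := Real.add_one_le_exp (p * (b C + b C ^ 2))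
    nlinarith

/-- The number of clauses of `F` in which `y` appears. -/
noncomputable def degree (F : Formula n) (y : Fin n) : ℕ := (F.filter fun C => y ∈ vars C).card

theorem sum_mem_vars_le_three (C : Clause n) (T : Finset (Fin n)) :
    ∑ y ∈ T, (if y ∈ vars C then (1 : ℝ) else 0) ≤ 3 := by
  rw [Finset.sum_boole]
  have : (T.filter fun y => y ∈ vars C) ⊆ vars C := fun y hy => (Finset.mem_filter.1 hy).2
  exact_mod_cast (Finset.card_le_card this).trans (card_vars C).le

theorem sum_satClauses_mem_vars_le (φ : Assignment n) (T : Finset (Fin n)) :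
    ∑ C ∈ satClauses φ, ∑ y ∈ T, (if y ∈ vars C then (1 : ℝ) else 0)
      ≤ T.card * (8 * (n : ℝ) ^ 2) := by
  rw [Finset.sum_comm, ← nsmul_eq_mul]
  refine Finset.sum_le_card_nsmul _ _ _ fun y _ => ?_
  rw [Finset.sum_boole]
  exact_mod_cast (Finset.card_le_card (Finset.filter_subset_filter _ (Finset.subset_univ _))).trans
    (card_clauses_mem_vars_le y)

theorem formulaProb_degree_le (h0 : 0 ≤ p) (h1 : p ≤ 1) (T : Finset (Fin n)) {d : ℝ}
    (hd : d = (n : ℝ) ^ 2 * p) :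
    formulaProb p φ (fun F => 20 * d * T.card ≤ ∑ y ∈ T, (degree F y : ℝ))
      ≤ Real.exp (-(4 / 3 * (d * T.card))) := by
  -- The factor `1 / 3` brings the contribution of a clause, which has three variables, into `[0,
  -- 1]`.
  set b : Clause n → ℝ := fun C => 1 / 3 * ∑ y ∈ T, (if y ∈ vars C then (1 : ℝ) else 0) with hbdef
  have hb0 : ∀ C, 0 ≤ b C := fun C => by positivity
  have hb1 : ∀ C, b C ≤ 1 := fun C => by
    have := sum_mem_vars_le_three C T
    simp only [b]; linarith
  have h := formulaProb_sum_ge_le (φ := φ) h0 h1 b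
    (fun C => abs_le.2 ⟨by linarith [hb0 C], hb1 C⟩) (20 / 3 * d * T.card)
  refine (formulaProb_mono h0 h1 fun F hF => ?_).trans (h.trans (Real.exp_le_exp.2 ?_))
  · have : ∑ y ∈ T, (degree F y : ℝ) = ∑ C ∈ F, ∑ y ∈ T, (if y ∈ vars C then (1 : ℝ) else 0) := by
      rw [Finset.sum_comm]
      simp [degree]
    simp only [b]
    rw [← Finset.mul_sum, ← this]
    linarith
  · have h2 : ∑ C ∈ satClauses φ, (b C + b C ^ 2) ≤ ∑ C ∈ satClauses φ, 2 * b C :=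
      Finset.sum_le_sum fun C _ => by nlinarith [hb0 C, hb1 C]
    have h3 := sum_satClauses_mem_vars_le φ T
    rw [← Finset.mul_sum, hbdef, ← Finset.mul_sum] at h2
    have h4 : ∑ C ∈ satClauses φ, (b C + b C ^ 2) ≤ 16 / 3 * (T.card * (n : ℝ) ^ 2) := by linarith
    have h5 := mul_le_mul_of_nonneg_left h4 h0
    rw [hd]
    nlinarith

theorem formulaProb_Nsupp_le (h0 : 0 ≤ p) (h1 : p ≤ 1) (T : Finset (Fin n)) {d : ℝ}
    (hd : d = (n : ℝ) ^ 2 * p) (hn : 1000 ≤ n) :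
    formulaProb p φ (fun F => ∑ y ∈ T, ((Nsupp φ F y).card : ℝ) ≤ d / 3 * T.card)
      ≤ Real.exp (-(1 / 100 * (d * T.card))) := by
  set a : Clause n → ℝ := fun C => ∑ y ∈ T, (if Supports φ y C then (1 : ℝ) else 0) with hadef
  -- A clause has at most one supporting variable.
  have ha : ∀ C, a C = 0 ∨ a C = 1 := fun C => by
    by_cases hC : ∃ y ∈ T, Supports φ y C
    · right
      obtain ⟨y, hy, hs⟩ := hC
      simp only [a]
      rw [Finset.sum_eq_single_of_mem y hy fun z _ hz => if_neg fun h => hz (h.unique hs),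
        if_pos hs]
    · left
      push Not at hC
      exact Finset.sum_eq_zero fun y hy => if_neg (hC y hy)
  have h := formulaProb_sum_ge_le (φ := φ) h0 h1 (fun C => -(1 / 10) * a C)
    (fun C => by rcases ha C with h | h <;> rw [h] <;> norm_num [abs_le]) (-(d / 30 * T.card))
  have hsum : ∀ F : Formula n, ∑ C ∈ F, a C = ∑ y ∈ T, ((Nsupp φ F y).card : ℝ) := fun F => by
    rw [hadef, Finset.sum_comm]
    simp [Nsupp]
  refine (formulaProb_mono h0 h1 fun F hF => ?_).trans (h.trans (Real.exp_le_exp.2 ?_))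
  · rw [← Finset.mul_sum, hsum]
    linarith
  · have h2 : ∑ C ∈ satClauses φ, (-(1 / 10) * a C + (-(1 / 10) * a C) ^ 2)
        = -(9 / 100) * ∑ C ∈ satClauses φ, a C := by
      rw [Finset.mul_sum]
      refine Finset.sum_congr rfl fun C _ => ?_
      rcases ha C with h | h <;> rw [h] <;> norm_num
    have h3 : (T.card : ℝ) * (0.495 * (n : ℝ) ^ 2) ≤ ∑ C ∈ satClauses φ, a C := by
      rw [hsum, ← nsmul_eq_mul]
      refine Finset.card_nsmul_le_sum _ _ _ fun y _ => ?_
      have h4 : (((n - 1).choose 2 : ℕ) : ℝ) ≤ ((Nsupp φ (satClauses φ) y).card : ℝ) := by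
        exact_mod_cast choose_le_card_Nsupp_satClauses φ y
      refine le_trans ?_ h4
      have hn' : (1000 : ℝ) ≤ n := by exact_mod_cast hn
      rw [Nat.cast_choose_two, Nat.cast_sub (by omega)]
      push_cast
      nlinarith
    rw [h2]
    have h5 := mul_le_mul_of_nonneg_left h3 h0
    rw [hd]
    have h6 : (0 : ℝ) ≤ T.card * (n : ℝ) ^ 2 * p := by positivity
    nlinarith

theorem abs_Npp_sub_Nneg_le (C : Clause n) (y : Fin n) :
    |(if (y, φ y) ∈ C.1 ∧ ¬ Supports φ y C then (1 : ℝ) else 0)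
      - (if (y, !φ y) ∈ C.1 then 1 else 0)| ≤ if y ∈ vars C then 1 else 0 := by
  by_cases hy : y ∈ vars C
  · simp only [hy, if_true]
    split_ifs <;> norm_num
  · have h1 : ∀ b, (y, b) ∉ C.1 := fun b hb => hy (mem_vars.2 ⟨b, hb⟩)
    simp [h1, hy]

theorem formulaProb_balance_le (h0 : 0 ≤ p) (h1 : p ≤ 1) (T : Finset (Fin n)) {d : ℝ}
    (hd : d = (n : ℝ) ^ 2 * p) {η : ℝ} (hη : |η| = 1) :
    formulaProb p φ (fun F => d / 60 * T.card ≤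
        ∑ y ∈ T, η * (((Npp φ F y).card : ℝ) - ((Nneg φ F y).card : ℝ)))
      ≤ Real.exp (-(1 / 345600 * (d * T.card))) := by
  set a : Clause n → ℝ := fun C => ∑ y ∈ T,
    ((if (y, φ y) ∈ C.1 ∧ ¬ Supports φ y C then (1 : ℝ) else 0)
      - (if (y, !φ y) ∈ C.1 then 1 else 0)) with hadef
  have haT : ∀ C, |a C| ≤ ∑ y ∈ T, (if y ∈ vars C then (1 : ℝ) else 0) := fun C =>
    (Finset.abs_sum_le_sum_abs _ _).trans (Finset.sum_le_sum fun y _ => abs_Npp_sub_Nneg_le C y)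
  have ha3 : ∀ C, |a C| ≤ 3 := fun C => (haT C).trans (sum_mem_vars_le_three C T)
  -- The first-order term vanishes and the second moment is at most `24 * d * T.card`, so the
  -- exponent is `24 * l ^ 2 - l / 60` per unit of `d * T.card`, minimal at `l = 1 / 2880`.
  have h := formulaProb_sum_ge_le (φ := φ) h0 h1 (fun C => η / 2880 * a C)
    (fun C => by
      rw [abs_mul, abs_div, hη]
      have := ha3 C
      norm_num
      linarith) (d / 60 / 2880 * T.card)
  have hsum : ∀ F : Formula n, ∑ C ∈ F, a C
      = ∑ y ∈ T, (((Npp φ F y).card : ℝ) - ((Nneg φ F y).card : ℝ)) := fun F => by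
    rw [hadef, Finset.sum_comm]
    simp [Npp, Nneg]
  refine (formulaProb_mono h0 h1 fun F hF => ?_).trans (h.trans (Real.exp_le_exp.2 ?_))
  · rw [← Finset.mul_sum] at hF
    rw [← Finset.mul_sum, hsum]
    linarith
  · have h2 : ∑ C ∈ satClauses φ, a C = 0 := by
      rw [hsum]
      refine Finset.sum_eq_zero fun y _ => ?_
      rw [card_Npp_satClauses, sub_self]
    have h3 : ∑ C ∈ satClauses φ, a C ^ 2 ≤ 3 * (T.card * (8 * (n : ℝ) ^ 2)) := by
      refine le_trans ?_ (mul_le_mul_of_nonneg_left (sum_satClauses_mem_vars_le φ T)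
        (by norm_num : (0 : ℝ) ≤ 3))
      rw [Finset.mul_sum]
      refine Finset.sum_le_sum fun C _ => ?_
      rw [← sq_abs]
      nlinarith [haT C, ha3 C, abs_nonneg (a C)]
    have hη2 : η ^ 2 = 1 := by rw [← sq_abs, hη]; norm_num
    have h4 : ∑ C ∈ satClauses φ, (η / 2880 * a C + (η / 2880 * a C) ^ 2)
        = 1 / 2880 ^ 2 * ∑ C ∈ satClauses φ, a C ^ 2 := by
      rw [Finset.sum_add_distrib, ← Finset.mul_sum, h2, mul_zero, zero_add, Finset.mul_sum]
      refine Finset.sum_congr rfl fun C _ => ?_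
      rw [mul_pow, div_pow, hη2]
    rw [h4]
    have h5 := mul_le_mul_of_nonneg_left h3 h0
    rw [hd]
    have h6 : (0 : ℝ) ≤ T.card * (n : ℝ) ^ 2 * p := by positivity
    nlinarith

theorem formulaProb_dense_le (h0 : 0 ≤ p) (h1 : p ≤ 1) (U : Finset (Fin n)) (τ : ℝ) :
    formulaProb p φ (fun F => τ ≤ ((F.filter fun C => 2 ≤ (vars C ∩ U).card).card : ℝ))
      ≤ Real.exp (16 * ((U.card : ℝ) ^ 2 * n * p) - τ) := by
  have h := formulaProb_sum_ge_le (φ := φ) h0 h1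
    (fun C => if 2 ≤ (vars C ∩ U).card then (1 : ℝ) else 0)
    (fun C => by split_ifs <;> norm_num) τ
  refine (formulaProb_mono h0 h1 fun F hF => ?_).trans (h.trans (Real.exp_le_exp.2 ?_))
  · rwa [Finset.sum_boole]
  · have h2 : ∑ C ∈ satClauses φ, ((if 2 ≤ (vars C ∩ U).card then (1 : ℝ) else 0)
        + (if 2 ≤ (vars C ∩ U).card then (1 : ℝ) else 0) ^ 2)
        ≤ 2 * ((U.card : ℝ) ^ 2 * (8 * n)) := by
      have h3 : ∑ C ∈ satClauses φ, (if 2 ≤ (vars C ∩ U).card then (1 : ℝ) else 0)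
          ≤ (U.card : ℝ) ^ 2 * (8 * n) := by
        rw [Finset.sum_boole]
        exact_mod_cast (Finset.card_le_card (Finset.filter_subset_filter _
          (Finset.subset_univ _))).trans (card_clauses_two_vars_le U)
      simp only [ite_pow, one_pow, ne_eq, OfNat.ofNat_ne_zero, not_false_eq_true, zero_pow]
      rw [Finset.sum_add_distrib]
      linarith
    have h5 := mul_le_mul_of_nonneg_left h2 h0
    nlinarith

end Planted

/-! ### Few variables are lost in the removal procedure -/

section Removal

open scoped Classical

variable {n : ℕ} {d : ℝ} {φ : Assignment n} {F : Formula n}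

/-- Each step removes a single variable, so the size of the complement skips no value. -/
theorem exists_intermediate_of_reflTransGen {H₀ H : Finset (Fin n)} {t : ℕ}
    (h : Relation.ReflTransGen (RemovalStep d φ F) H₀ H)
    (h0 : (Finset.univ \ H₀).card ≤ t) (h1 : t ≤ (Finset.univ \ H).card) :
    ∃ H', Relation.ReflTransGen (RemovalStep d φ F) H₀ H' ∧ (Finset.univ \ H').card = t := by
  induction h with
  | refl => exact ⟨H₀, .refl, le_antisymm h0 h1⟩
  | @tail H₁ H₂ hr hs ih =>
    rcases le_or_gt t (Finset.univ \ H₁).card with hlt | hlt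
    · exact ih hlt
    · refine ⟨H₂, hr.tail hs, le_antisymm ?_ h1⟩
      obtain ⟨a, ha, -, rfl⟩ := hs
      have h3 := Finset.card_sdiff_add_card_inter (Finset.univ) H₁
      have h4 := Finset.card_sdiff_add_card_inter (Finset.univ) (H₁.erase a)
      rw [Finset.univ_inter] at h3 h4
      have h5 := Finset.card_erase_add_one ha
      omega

/-- If the support inside `induced F H` has dropped from above `d / 3` to below `d / 4`, then `a`
lies in more than `d / 12` clauses outside `induced F H`. Each such clause contains, besides `a`, a
variable outside `H`, so it meets the new complement twice. -/
theorem le_card_filter_of_removable {H : Finset (Fin n)} {a : Fin n} (ha : a ∈ H)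
    (hs : d / 3 < ((Nsupp φ F a).card : ℝ)) (hr : Removable d φ F H a) :
    d / 30 ≤ ((F.filter fun C =>
      a ∈ vars C ∧ 2 ≤ (vars C ∩ (Finset.univ \ H.erase a)).card).card : ℝ) := by
  have hsub : (F \ induced F H).filter (fun C => a ∈ vars C) ⊆ F.filter fun C =>
      a ∈ vars C ∧ 2 ≤ (vars C ∩ (Finset.univ \ H.erase a)).card := by
    intro C hC
    simp only [induced, Finset.mem_filter, Finset.mem_sdiff, not_and] at hC ⊢
    refine ⟨hC.1.1, hC.2, ?_⟩
    obtain ⟨b, hb, hbH⟩ := Finset.not_subset.1 (hC.1.2 hC.1.1)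
    refine Finset.one_lt_card.2 ⟨a, ?_, b, ?_, ?_⟩
    · simp [hC.2]
    · simp [hb, hbH]
    · rintro rfl; exact hbH ha
  refine le_trans ?_ (Nat.cast_le.2 (Finset.card_le_card hsub))
  rcases hr with hr | hr
  · have h1 : (Nsupp φ F a).card ≤ ((induced F H).filter fun C => Supports φ a C).card
        + ((F \ induced F H).filter fun C => a ∈ vars C).card := by
      rw [← Finset.card_union_add_card_inter]
      refine le_trans (Finset.card_le_card fun C hC => ?_) (Nat.le_add_right _ _)
      simp only [Nsupp, Finset.mem_filter] at hC
      simp only [Finset.mem_union, Finset.mem_filter, Finset.mem_sdiff]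
      by_cases hi : C ∈ induced F H
      · exact Or.inl ⟨hi, hC.2⟩
      · exact Or.inr ⟨⟨hC.1, hi⟩, hC.2.mem_vars⟩
    have h2 : ((Nsupp φ F a).card : ℝ) ≤ (((induced F H).filter fun C => Supports φ a C).card : ℝ)
        + (((F \ induced F H).filter fun C => a ∈ vars C).card : ℝ) := by exact_mod_cast h1
    linarith
  · exact hr.le

theorem le_card_filter_of_reflTransGen {H₀ H : Finset (Fin n)}
    (hs : ∀ a ∈ H₀, d / 3 < ((Nsupp φ F a).card : ℝ))
    (h : Relation.ReflTransGen (RemovalStep d φ F) H₀ H) :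
    H ⊆ H₀ ∧ ∀ a ∈ H₀ \ H, d / 30 ≤ ((F.filter fun C =>
      a ∈ vars C ∧ 2 ≤ (vars C ∩ (Finset.univ \ H)).card).card : ℝ) := by
  induction h with
  | refl => simp
  | @tail H₁ H₂ _ hstep ih =>
    obtain ⟨b, hb, hr, rfl⟩ := hstep
    refine ⟨(Finset.erase_subset _ _).trans ih.1, fun a ha => ?_⟩
    by_cases hab : a = b
    · subst hab
      exact le_card_filter_of_removable hb (hs a (ih.1 hb)) hr
    · have ha' : a ∈ H₀ \ H₁ := by
        simp only [Finset.mem_sdiff, Finset.mem_erase, not_and] at ha ⊢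
        exact ⟨ha.1, ha.2 hab⟩
      -- For variables removed earlier the count can only grow, since the complement grows.
      refine (ih.2 a ha').trans (Nat.cast_le.2 (Finset.card_le_card fun C hC => ?_))
      simp only [Finset.mem_filter] at hC ⊢
      refine ⟨hC.1, hC.2.1, hC.2.2.trans (Finset.card_le_card ?_)⟩
      exact Finset.inter_subset_inter_left
        (Finset.sdiff_subset_sdiff subset_rfl (Finset.erase_subset _ _))

theorem sum_card_filter_le (F : Formula n) (A U : Finset (Fin n)) :
    ∑ a ∈ A, ((F.filter fun C => a ∈ vars C ∧ 2 ≤ (vars C ∩ U).card).card : ℝ)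
      ≤ 3 * ((F.filter fun C => 2 ≤ (vars C ∩ U).card).card : ℝ) := by
  have h : ∀ a, ((F.filter fun C => a ∈ vars C ∧ 2 ≤ (vars C ∩ U).card).card : ℝ)
      = ∑ C ∈ F with 2 ≤ (vars C ∩ U).card, if a ∈ vars C then (1 : ℝ) else 0 := by
    intro a
    rw [Finset.sum_boole, Finset.filter_filter]
    simp only [and_comm]
  simp only [h]
  rw [Finset.sum_comm, mul_comm, ← nsmul_eq_mul]
  exact Finset.sum_le_card_nsmul _ _ _ fun C _ => sum_mem_vars_le_three C A

/-- Stop when the complement has size `t`. At least `t / 2` variables have then been removed, each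
in `d / 30` clauses meeting the complement twice, and a clause is counted at most three times: `t /
2 * (d / 30) / 3 = t * d / 180`. -/
theorem card_compl_lt_of_reflTransGen {H₀ H : Finset (Fin n)} {t : ℕ} (hd : 0 ≤ d)
    (hs : ∀ a ∈ H₀, d / 3 < ((Nsupp φ F a).card : ℝ))
    (hdense : ∀ U : Finset (Fin n), U.card = t →
      ((F.filter fun C => 2 ≤ (vars C ∩ U).card).card : ℝ) < t * d / 180)
    (h0 : 2 * ((Finset.univ \ H₀).card : ℝ) ≤ t)
    (h : Relation.ReflTransGen (RemovalStep d φ F) H₀ H) : (Finset.univ \ H).card < t := by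
  by_contra! hlt
  obtain ⟨H', hr, ht⟩ := exists_intermediate_of_reflTransGen h
    (by have : 2 * (Finset.univ \ H₀).card ≤ t := by exact_mod_cast h0
        omega) hlt
  obtain ⟨hsub, hmany⟩ := le_card_filter_of_reflTransGen hs hr
  have h1 := Finset.card_nsmul_le_sum _ _ _ hmany
  have h2 := sum_card_filter_le F (H₀ \ H') (Finset.univ \ H')
  have h3 := hdense _ ht
  have h4 : ((H₀ \ H').card : ℝ) = t - ((Finset.univ \ H₀).card : ℝ) := by
    have h5 := Finset.card_sdiff_add_card_eq_card hsub
    have h6 := Finset.card_sdiff_add_card_eq_card (Finset.subset_univ H₀)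
    have h7 := Finset.card_sdiff_add_card_eq_card (Finset.subset_univ H')
    rw [eq_sub_iff_add_eq]
    exact_mod_cast (by omega : (H₀ \ H').card + (Finset.univ \ H₀).card = t)
  rw [nsmul_eq_mul, h4] at h1
  nlinarith

end Removal

/-! ### Messages and orders in terms of signed sums over the edges into a variable -/

section Edges

open scoped Classical

variable {n : ℕ} {φ : Assignment n} {F : Formula n}

/-- The variable to which the message along an edge is sent. -/
def target (e : Edge F) : Fin n := e.1.2

/-- The sign of an edge `C → y`: `1` if `C ∈ N^{++}(y)`, `-1` if `C ∈ N^-(y)`. -/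
noncomputable def edgeSign (φ : Assignment n) (F : Formula n) (e : Edge F) : ℝ :=
  (if e.1.1 ∈ Npp φ F e.1.2 then 1 else 0) - if e.1.1 ∈ Nneg φ F e.1.2 then 1 else 0

/-- The indicator of the edges `C → y` for which `y` supports `C`. -/
noncomputable def edgeSupp (φ : Assignment n) (F : Formula n) (e : Edge F) : ℝ :=
  if e.1.1 ∈ Nsupp φ F e.1.2 then 1 else 0

theorem edgeSign_eq (e : Edge F) :
    edgeSign φ F e = 1 ∨ edgeSign φ F e = -1 ∨ edgeSign φ F e = 0 := by
  unfold edgeSign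
  split_ifs <;> norm_num

theorem abs_edgeSign_le (e : Edge F) : |edgeSign φ F e| ≤ 1 := by
  rcases edgeSign_eq (φ := φ) e with h | h | h <;> rw [h] <;> norm_num

theorem edgeSupp_eq (e : Edge F) : edgeSupp φ F e = 0 ∨ edgeSupp φ F e = 1 := by
  unfold edgeSupp
  split_ifs <;> norm_num

theorem sum_edges_into (y : Fin n) (g : Clause n → ℝ) :
    ∑ e : Edge F with target e = y, g e.1.1 = ∑ C ∈ F with y ∈ vars C, g C := by
  refine Finset.sum_nbij (fun e => e.1.1) ?_ ?_ ?_ fun _ _ => rfl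
  · rintro ⟨⟨C, x⟩, he⟩ h
    obtain rfl : x = y := (Finset.mem_filter.1 h).2
    simpa [edges] using he
  · rintro ⟨⟨C, x⟩, he⟩ h ⟨⟨C', x'⟩, he'⟩ h' hCC
    obtain rfl : x = y := (Finset.mem_filter.1 h).2
    obtain rfl : x' = x := (Finset.mem_filter.1 h').2
    obtain rfl : C = C' := hCC
    rfl
  · intro C hC
    simp only [Finset.coe_filter, Set.mem_ofPred_eq] at hC
    exact ⟨⟨(C, y), by simpa [edges] using hC⟩, Finset.mem_filter.2 ⟨Finset.mem_univ _, rfl⟩, rfl⟩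

theorem card_target_eq (y : Fin n) :
    ((Finset.univ.filter fun e : Edge F => target e = y).card : ℝ) = degree F y := by
  have := sum_edges_into (F := F) y fun _ => 1
  simpa [degree] using this

theorem mem_vars_of_mem_Npp {y : Fin n} {C : Clause n} (h : C ∈ Npp φ F y) :
    C ∈ F ∧ y ∈ vars C := by
  simp only [Npp, Finset.mem_filter] at h
  exact ⟨h.1, mem_vars.2 ⟨_, h.2.1⟩⟩

theorem mem_vars_of_mem_Nneg {y : Fin n} {C : Clause n} (h : C ∈ Nneg φ F y) :
    C ∈ F ∧ y ∈ vars C := by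
  simp only [Nneg, Finset.mem_filter] at h
  exact ⟨h.1, mem_vars.2 ⟨_, h.2⟩⟩

theorem mem_vars_of_mem_Nsupp {y : Fin n} {C : Clause n} (h : C ∈ Nsupp φ F y) :
    C ∈ F ∧ y ∈ vars C := by
  simp only [Nsupp, Finset.mem_filter] at h
  exact ⟨h.1, h.2.mem_vars⟩

theorem sum_edges_into_indicator (y : Fin n) {𝒞 : Finset (Clause n)}
    (h : ∀ C ∈ 𝒞, C ∈ F ∧ y ∈ vars C) :
    ∑ e : Edge F with target e = y, (if e.1.1 ∈ 𝒞 then (1 : ℝ) else 0) = 𝒞.card := by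
  rw [sum_edges_into y fun C => if C ∈ 𝒞 then (1 : ℝ) else 0, Finset.sum_boole,
    Finset.filter_filter]
  congr 2
  ext C
  simp only [Finset.mem_filter]
  exact ⟨fun h => h.2.2, fun hC => ⟨(h C hC).1, (h C hC).2, hC⟩⟩

theorem sum_edgeSign (y : Fin n) :
    ∑ e : Edge F with target e = y, edgeSign φ F e
      = ((Npp φ F y).card : ℝ) - ((Nneg φ F y).card : ℝ) := by
  rw [← sum_edges_into_indicator y fun C => mem_vars_of_mem_Npp (C := C) (φ := φ) (F := F),
    ← sum_edges_into_indicator y fun C => mem_vars_of_mem_Nneg (C := C) (φ := φ) (F := F),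
    ← Finset.sum_sub_distrib]
  refine Finset.sum_congr rfl fun e he => ?_
  replace he : e.1.2 = y := (Finset.mem_filter.1 he).2
  rw [edgeSign, he]

theorem sum_edgeSupp (y : Fin n) :
    ∑ e : Edge F with target e = y, edgeSupp φ F e = ((Nsupp φ F y).card : ℝ) := by
  rw [← sum_edges_into_indicator y fun C => mem_vars_of_mem_Nsupp (C := C) (φ := φ) (F := F)]
  refine Finset.sum_congr rfl fun e he => ?_
  replace he : e.1.2 = y := (Finset.mem_filter.1 he).2
  rw [edgeSupp, he]

theorem card_filter_eq_sum_target (P : Edge F → Prop) [DecidablePred P] (y : Fin n) (h : ∀ e, P e → target e = y) :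
    ((Finset.univ.filter P).card : ℝ)
      = ∑ e : Edge F with target e = y, if P e then (1 : ℝ) else 0 := by
  rw [Finset.sum_boole, Finset.filter_filter]
  congr 2
  ext e
  simp only [Finset.mem_filter, Finset.mem_univ, true_and]
  exact ⟨fun he => ⟨h e he, he⟩, fun he => he.2⟩

theorem card_before_sub_card_before (π : EdgeOrder F) (i : Fin (edges F).card) (y : Fin n) :
    ((restrict (before π i (y, φ y)) (Npp φ F y)).card : ℝ) -
      ((restrict (before π i (y, !φ y)) (Nneg φ F y)).card : ℝ)
      = excess target (edgeSign φ F) 1 π i y := by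
  simp only [restrict, before, Finset.filter_filter]
  rw [card_filter_eq_sum_target _ y fun e he => he.1.2.1,
    card_filter_eq_sum_target _ y fun e he => he.1.2.1, ← Finset.sum_sub_distrib, excess]
  refine Finset.sum_congr rfl fun e he => ?_
  replace he : e.1.2 = y := (Finset.mem_filter.1 he).2
  simp only [he, edgeSign, Npp, Nneg, Finset.mem_filter, Fin.lt_def, Pi.one_apply]
  by_cases h1 : (π e : ℕ) < i
  · simp only [h1, true_and, if_true, mul_one]
    congr 2 <;> simp
    tauto
  · simp [h1]

theorem card_ones_before_sub_card_ones_before (α : Messages F) (π : EdgeOrder F)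
    (i : Fin (edges F).card) (y : Fin n) :
    ((ones α (restrict (before π i (y, φ y)) (Npp φ F y))).card : ℝ) -
      ((ones α (restrict (before π i (y, !φ y)) (Nneg φ F y))).card : ℝ)
      = excess target (edgeSign φ F) (fun e => bit (α e)) π i y := by
  simp only [ones, restrict, before, Finset.filter_filter]
  rw [card_filter_eq_sum_target _ y fun e he => he.1.1.2.1,
    card_filter_eq_sum_target _ y fun e he => he.1.1.2.1, ← Finset.sum_sub_distrib, excess]
  refine Finset.sum_congr rfl fun e he => ?_
  replace he : e.1.2 = y := (Finset.mem_filter.1 he).2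
  simp only [he, edgeSign, Npp, Nneg, Finset.mem_filter, Fin.lt_def, bit]
  by_cases h1 : (π e : ℕ) < i
  · by_cases h2 : α e = true
    · simp only [h1, h2, true_and, and_true, if_true, mul_one]
      congr 2 <;> simp
      tauto
    · simp [h2]
  · simp [h1]

/-- Place `(edges F).card` lies beyond every edge, so the unordered condition is one more initial
segment; this is why `excess` takes a natural number as its place. -/
theorem card_ones_sub_card_ones (α : Messages F) (π : EdgeOrder F) (y : Fin n) :
    ((ones α (edgesInto F (Npp φ F y) y)).card : ℝ) -
      ((ones α (edgesInto F (Nneg φ F y) y)).card : ℝ)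
      = excess target (edgeSign φ F) (fun e => bit (α e)) π (edges F).card y := by
  simp only [ones, edgesInto, Finset.filter_filter]
  rw [card_filter_eq_sum_target _ y fun e he => he.1.2,
    card_filter_eq_sum_target _ y fun e he => he.1.2, ← Finset.sum_sub_distrib, excess]
  refine Finset.sum_congr rfl fun e he => ?_
  replace he : e.1.2 = y := (Finset.mem_filter.1 he).2
  simp only [he, edgeSign, bit, (π e).isLt, if_true, mul_one, and_true]
  by_cases h2 : α e = true <;> simp [h2]

theorem card_ones_Nsupp (α : Messages F) (y : Fin n) :
    ((ones α (edgesInto F (Nsupp φ F y) y)).card : ℝ)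
      = ∑ e : Edge F with target e = y, edgeSupp φ F e * bit (α e) := by
  simp only [ones, edgesInto, Finset.filter_filter]
  rw [card_filter_eq_sum_target _ y fun e he => he.1.2]
  refine Finset.sum_congr rfl fun e he => ?_
  replace he : e.1.2 = y := (Finset.mem_filter.1 he).2
  simp only [he, edgeSupp, bit, and_true]
  by_cases h2 : α e = true <;> simp [h2]

end Edges

/-! ### Exceptional variables -/

section Exceptional

open scoped Classical

variable {n : ℕ}

/-- The properties of the planted formula on which the proof relies. -/
structure FormulaGood (d : ℝ) (r t : ℕ) (φ : Assignment n) (F : Formula n) : Prop where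
  degree : ∀ T : Finset (Fin n), T.card = r → ∑ y ∈ T, (degree F y : ℝ) < 20 * d * T.card
  supp : ∀ T : Finset (Fin n), T.card = r → d / 3 * T.card < ∑ y ∈ T, ((Nsupp φ F y).card : ℝ)
  pos : ∀ T : Finset (Fin n), T.card = r →
    ∑ y ∈ T, 1 * (((Npp φ F y).card : ℝ) - ((Nneg φ F y).card : ℝ)) < d / 60 * T.card
  neg : ∀ T : Finset (Fin n), T.card = r →
    ∑ y ∈ T, -1 * (((Npp φ F y).card : ℝ) - ((Nneg φ F y).card : ℝ)) < d / 60 * T.card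
  dense : ∀ U : Finset (Fin n), U.card = t →
    ((F.filter fun C => 2 ≤ (vars C ∩ U).card).card : ℝ) < t * d / 180

/-- The formula is typical near `y`. -/
structure Regular (d : ℝ) (φ : Assignment n) (F : Formula n) (y : Fin n) : Prop where
  supp : d / 3 < ((Nsupp φ F y).card : ℝ)
  balance : |((Npp φ F y).card : ℝ) - ((Nneg φ F y).card : ℝ)| ≤ d / 60
  degree : (degree F y : ℝ) ≤ 20 * d

/-- Some initial segment of the order is unbalanced at `y`. -/
def OrderBad (d : ℝ) (φ : Assignment n) (F : Formula n) (π : EdgeOrder F) (y : Fin n) : Prop :=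
  ∃ i : ℕ, d / 30 < |excess target (edgeSign φ F) 1 π i y|

/-- The messages equal to `1` in some initial segment of the order are unbalanced at `y`. -/
def BitsBad (d : ℝ) (φ : Assignment n) (F : Formula n) (α : Messages F) (π : EdgeOrder F)
    (y : Fin n) : Prop :=
  ∃ i : ℕ, d / 30 < |excess target (edgeSign φ F) (fun e => bit (α e)) π i y|

/-- Few of the messages to `y` from the clauses that it supports are `1`. -/
def SuppBad (d : ℝ) (φ : Assignment n) (F : Formula n) (α : Messages F) (y : Fin n) : Prop :=
  ∑ e : Edge F with target e = y, edgeSupp φ F e * bit (α e) < d / 7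

/-- The variables near which the formula, the order or the messages are not typical. -/
def Exceptional (d : ℝ) (φ : Assignment n) (F : Formula n) (α : Messages F) (π : EdgeOrder F)
    (y : Fin n) : Prop :=
  ¬ Regular d φ F y ∨ (Regular d φ F y ∧ OrderBad d φ F π y) ∨
    (Regular d φ F y ∧ ¬ OrderBad d φ F π y ∧ BitsBad d φ F α π y) ∨
    (Regular d φ F y ∧ SuppBad d φ F α y)

variable {d : ℝ} {φ : Assignment n} {F : Formula n} {α : Messages F} {π : EdgeOrder F}

theorem typical_of_not_exceptional {y : Fin n} (hd : 0 ≤ d) (h : ¬ Exceptional d φ F α π y) :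
    Regular d φ F y ∧ ∀ i, StableAt d φ F π i y ∧ ¬ ViolatedAt d φ F α π i y := by
  simp only [Exceptional, not_or, not_and, not_not] at h
  obtain ⟨hr, ho, hb, hs⟩ := h
  have ho' := ho hr
  have hb' := hb hr ho'
  have hs' := hs hr
  simp only [OrderBad, BitsBad, SuppBad, not_exists, not_lt] at ho' hb' hs'
  refine ⟨hr, fun i => ⟨⟨?_, ?_, hr.supp.le⟩, ?_⟩⟩
  · rw [card_before_sub_card_before]
    exact ho' _
  · linarith [hr.balance]
  · rw [ViolatedAt, card_ones_before_sub_card_ones_before, card_ones_sub_card_ones α π,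
      card_ones_Nsupp]
    push Not
    exact ⟨hb' _, hb' _, hs'⟩

/-- A variable of low support is itself exceptional; an unstable or violated one is so because of
some `y` in a common clause, and this `y` is exceptional. -/
theorem compl_initialSet_subset (hd : 0 ≤ d) :
    Finset.univ \ initialSet d φ F α π ⊆
      (Finset.univ.filter (Exceptional d φ F α π)) ∪
        (Finset.univ.filter (Exceptional d φ F α π)).biUnion fun y =>
          (F.filter fun C => y ∈ vars C).biUnion vars := by
  intro x hx
  have hnear : ∀ e : Edge F, e.1.2 = x → ∀ y ∈ vars e.1.1, Exceptional d φ F α π y →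
      x ∈ (Finset.univ.filter (Exceptional d φ F α π)).biUnion fun y =>
          (F.filter fun C => y ∈ vars C).biUnion vars := by
    rintro ⟨⟨C, x'⟩, he⟩ hex y hy hE
    obtain rfl : x' = x := hex
    simp only [edges, Finset.mem_filter, Finset.mem_univ, true_and] at he
    simp only [Finset.mem_biUnion, Finset.mem_filter, Finset.mem_univ, true_and]
    exact ⟨y, hE, C, ⟨he.1, hy⟩, he.2⟩
  simp only [initialSet, Finset.mem_sdiff, Finset.mem_univ, true_and, not_not, Finset.mem_union,
    lowSupport, unstable, stableViolated, Finset.mem_filter] at hx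
  rw [Finset.mem_union]
  rcases hx with (hx | hx) | ⟨-, hx⟩
  · left
    rw [Finset.mem_filter]
    refine ⟨Finset.mem_univ _, by_contra fun h => ?_⟩
    exact absurd (typical_of_not_exceptional hd h).1.supp (not_lt.2 hx)
  · right
    simp only [Stable, not_forall] at hx
    obtain ⟨e, hex, y, hy, -, hst⟩ := hx
    exact hnear e hex y hy (by_contra fun h => hst ((typical_of_not_exceptional hd h).2 _).1)
  · right
    obtain ⟨e, hex, y, hy, -, hv⟩ := hx
    exact hnear e hex y hy (by_contra fun h => ((typical_of_not_exceptional hd h).2 _).2 hv)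

theorem card_neighbourhood_le (F : Formula n) (B : Finset (Fin n)) :
    ((B ∪ B.biUnion fun y => (F.filter fun C => y ∈ vars C).biUnion vars).card : ℝ)
      ≤ ∑ y ∈ B, (1 + 3 * (degree F y : ℝ)) := by
  have h1 : (B.biUnion fun y => (F.filter fun C => y ∈ vars C).biUnion vars).card
      ≤ ∑ y ∈ B, degree F y * 3 :=
    Finset.card_biUnion_le.trans (Finset.sum_le_sum fun y _ =>
      Finset.card_biUnion_le_card_mul _ _ _ fun C _ => (card_vars C).le)
  have h2 := (Finset.card_union_le B
    (B.biUnion fun y => (F.filter fun C => y ∈ vars C).biUnion vars)).trans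
      (Nat.add_le_add_left h1 _)
  refine (Nat.cast_le.2 h2).trans (le_of_eq ?_)
  push_cast
  rw [Finset.sum_add_distrib, Finset.card_eq_sum_ones]
  push_cast
  congr 1
  exact Finset.sum_congr rfl fun y _ => mul_comm _ _

/-- The number of variables with the property `P`. -/
noncomputable def count (P : Fin n → Prop) : ℕ := (Finset.univ.filter P).card

/-- A bound for the number of variables that have the property `P` or share a clause of `F` with
a variable that has it. -/
noncomputable def mass (F : Formula n) (P : Fin n → Prop) : ℝ :=
  ∑ y with P y, (1 + 3 * (degree F y : ℝ))

theorem count_lt_of_forall {r : ℕ} {P : Fin n → Prop}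
    (h : ∀ T : Finset (Fin n), T.card = r → ¬ ∀ y ∈ T, P y) : count P < r := by
  by_contra! hr
  obtain ⟨T, hT, hTr⟩ := Finset.exists_subset_card_eq hr
  exact h T hTr fun y hy => (Finset.mem_filter.1 (hT hy)).2

theorem mass_or_le (F : Formula n) (P Q : Fin n → Prop) :
    mass F (fun y => P y ∨ Q y) ≤ mass F P + mass F Q := by
  simp only [mass, Finset.sum_filter]
  rw [← Finset.sum_add_distrib]
  refine Finset.sum_le_sum fun y _ => ?_
  have : 0 ≤ 1 + 3 * (degree F y : ℝ) := by positivity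
  by_cases h : P y <;> by_cases h' : Q y <;> simp [h, h', this]

variable {r t : ℕ}

theorem mass_mono (F : Formula n) {P Q : Fin n → Prop} (h : ∀ y, P y → Q y) :
    mass F P ≤ mass F Q :=
  Finset.sum_le_sum_of_subset_of_nonneg (Finset.monotone_filter_right _ fun y _ => h y)
    fun _ _ _ => by positivity

/-- `FormulaGood` bounds degrees only over sets of exactly `r` variables, so the set of bad
variables is first enlarged. The factor `r - 1` makes the bound vanish for `r = 1`, when there are
no bad variables; this matters when `e^{-cd} n` is small. -/
theorem FormulaGood.mass_le (hF : FormulaGood d r t φ F) (hd : 1 ≤ d) (hrn : r ≤ n)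
    {P : Fin n → Prop} (hP : count P < r) :
    mass F P ≤ 122 * d * ((r : ℝ) - 1) := by
  unfold count at hP
  unfold mass
  rcases (Finset.univ.filter P).eq_empty_or_nonempty with h | h
  · rw [h, Finset.sum_empty]
    have : (1 : ℝ) ≤ r := by exact_mod_cast (by omega : 1 ≤ r)
    have : (0 : ℝ) ≤ r - 1 := by linarith
    positivity
  · have h1 := h.card_pos
    obtain ⟨T, hT, hTr⟩ := Finset.exists_superset_card_eq hP.le (by simpa using hrn)
    have h2 := hF.degree T hTr
    rw [hTr] at h2
    have h3 : ∑ y with P y, (PlantedSAT.degree F y : ℝ) ≤ ∑ y ∈ T, (PlantedSAT.degree F y : ℝ) :=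
      Finset.sum_le_sum_of_subset_of_nonneg hT fun _ _ _ => by positivity
    rw [Finset.sum_add_distrib, ← Finset.mul_sum]
    simp only [Finset.sum_const, nsmul_eq_mul, mul_one]
    have h4 : ((Finset.univ.filter P).card : ℝ) ≤ r - 1 := by
      rw [le_sub_iff_add_le]
      exact_mod_cast hP
    -- A nonempty set with fewer than `r` elements forces `r ≥ 2`, so `r ≤ 2 * (r - 1)` and `60 * d
    -- * r` is absorbed into `120 * d * (r - 1)`.
    have h5 : (2 : ℝ) ≤ r := by exact_mod_cast (by omega : 2 ≤ r)
    nlinarith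

/-- Irregularity splits into four kinds and the order and messages give three more: `854 = 7 * 122`.
If all of `T` were irregular in one of the four ways, summing over `T` would contradict
`FormulaGood`. -/
theorem FormulaGood.mass_exceptional_le (hF : FormulaGood d r t φ F) (hd : 1 ≤ d) (hrn : r ≤ n)
    (ho : count (fun y => Regular d φ F y ∧ OrderBad d φ F π y) < r)
    (hb : count (fun y =>
      Regular d φ F y ∧ ¬ OrderBad d φ F π y ∧ BitsBad d φ F α π y) < r)
    (hs : count (fun y => Regular d φ F y ∧ SuppBad d φ F α y) < r) :
    mass F (Exceptional d φ F α π) ≤ 854 * d * ((r : ℝ) - 1) := by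
  have b1 := hF.mass_le hd hrn (P := fun y => ((Nsupp φ F y).card : ℝ) ≤ d / 3)
    (count_lt_of_forall fun T h hall => by
      have h1 := Finset.sum_le_card_nsmul T _ _ hall
      have h2 := hF.supp T h
      rw [nsmul_eq_mul] at h1
      linarith)
  have b2 := hF.mass_le hd hrn
    (P := fun y => d / 60 < ((Npp φ F y).card : ℝ) - ((Nneg φ F y).card : ℝ))
    (count_lt_of_forall fun T h hall => by
      have h1 := Finset.card_nsmul_le_sum T _ _ fun y hy => (hall y hy).le
      have h2 := hF.pos T h
      rw [nsmul_eq_mul] at h1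
      rw [← Finset.mul_sum] at h2
      linarith)
  have b3 := hF.mass_le hd hrn
    (P := fun y => ((Npp φ F y).card : ℝ) - ((Nneg φ F y).card : ℝ) < -(d / 60))
    (count_lt_of_forall fun T h hall => by
      have h1 := Finset.sum_le_card_nsmul T _ _ fun y hy => (hall y hy).le
      have h2 := hF.neg T h
      rw [nsmul_eq_mul] at h1
      rw [← Finset.mul_sum] at h2
      linarith)
  have b4 := hF.mass_le hd hrn (P := fun y => 20 * d < (PlantedSAT.degree F y : ℝ))
    (count_lt_of_forall fun T h hall => by
      have h1 := Finset.card_nsmul_le_sum T _ _ fun y hy => (hall y hy).le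
      have h2 := hF.degree T h
      rw [nsmul_eq_mul] at h1
      linarith)
  have b5 := hF.mass_le hd hrn ho
  have b6 := hF.mass_le hd hrn hb
  have b7 := hF.mass_le hd hrn hs
  have hirr := mass_mono F (P := fun y => ¬ Regular d φ F y)
    (Q := fun y => (((Nsupp φ F y).card : ℝ) ≤ d / 3 ∨
      d / 60 < ((Npp φ F y).card : ℝ) - ((Nneg φ F y).card : ℝ)) ∨
      (((Npp φ F y).card : ℝ) - ((Nneg φ F y).card : ℝ) < -(d / 60) ∨
      20 * d < (PlantedSAT.degree F y : ℝ))) fun y hy => by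
    by_contra! hc
    exact hy ⟨hc.1.1, abs_le.2 ⟨hc.2.1, hc.1.2⟩, hc.2.2⟩
  have s1 := hirr.trans (mass_or_le F _ _)
  have s2 := mass_or_le F (fun y => ((Nsupp φ F y).card : ℝ) ≤ d / 3)
    (fun y => d / 60 < ((Npp φ F y).card : ℝ) - ((Nneg φ F y).card : ℝ))
  have s3 := mass_or_le F
    (fun y => ((Npp φ F y).card : ℝ) - ((Nneg φ F y).card : ℝ) < -(d / 60))
    (fun y => 20 * d < (PlantedSAT.degree F y : ℝ))
  have s4 : mass F (Exceptional d φ F α π) ≤ _ := mass_or_le F _ _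
  have s5 := mass_or_le F (fun y => Regular d φ F y ∧ OrderBad d φ F π y)
    (fun y => (Regular d φ F y ∧ ¬ OrderBad d φ F π y ∧ BitsBad d φ F α π y) ∨
      (Regular d φ F y ∧ SuppBad d φ F α y))
  have s6 := mass_or_le F
    (fun y => Regular d φ F y ∧ ¬ OrderBad d φ F π y ∧ BitsBad d φ F α π y)
    (fun y => Regular d φ F y ∧ SuppBad d φ F α y)
  linarith

theorem FormulaGood.card_compl_core_lt (hF : FormulaGood d r t φ F) (hd : 1 ≤ d) (hrn : r ≤ n)
    (hr : 1 ≤ r) (hrt : 2000 * d * ((r : ℝ) - 1) ≤ t)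
    (ho : count (fun y => Regular d φ F y ∧ OrderBad d φ F π y) < r)
    (hb : count (fun y =>
      Regular d φ F y ∧ ¬ OrderBad d φ F π y ∧ BitsBad d φ F α π y) < r)
    (hs : count (fun y => Regular d φ F y ∧ SuppBad d φ F α y) < r)
    {H : Finset (Fin n)} (hH : IsCore d φ F α π H) : (Finset.univ \ H).card < t := by
  refine card_compl_lt_of_reflTransGen (by linarith) (fun a ha => ?_) hF.dense ?_ hH.1
  · simp only [initialSet, lowSupport, Finset.mem_sdiff, Finset.mem_union, Finset.mem_filter,
      Finset.mem_univ, true_and, not_or, not_le] at ha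
    exact ha.1.1
  · have h1 := hF.mass_exceptional_le hd hrn ho hb hs
    have h2 := card_neighbourhood_le F (Finset.univ.filter (Exceptional d φ F α π))
    have h3 : ((Finset.univ \ initialSet d φ F α π).card : ℝ) ≤ _ :=
      Nat.cast_le.2 (Finset.card_le_card (compl_initialSet_subset (α := α) (π := π) (by linarith)))
    have h4 : (1 : ℝ) ≤ r := by exact_mod_cast hr
    rw [← mass] at h2
    nlinarith [mul_nonneg (by linarith : (0 : ℝ) ≤ d) (by linarith : (0 : ℝ) ≤ (r : ℝ) - 1)]

end Exceptional

/-! ### Probability estimates -/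

section Estimates

open scoped Classical

variable {n : ℕ} {d : ℝ} {φ : Assignment n} {F : Formula n}

theorem uniformProb_count_le {Ω : Type} [Fintype Ω] (P : Ω → Fin n → Prop) (r : ℕ) {q : ℝ}
    (h : ∀ T : Finset (Fin n), T.card = r → uniformProb (fun ω => ∀ y ∈ T, P ω y) ≤ q ^ r) :
    uniformProb (fun ω => ¬ count (P ω) < r) ≤ n.choose r * q ^ r := by
  refine (uniformProb_mono (E' := fun ω => ∃ T ∈ Finset.powersetCard r Finset.univ,
    ∀ y ∈ T, P ω y) fun ω hω => ?_).trans ((uniformProb_exists_le _ _).trans ?_)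
  · by_contra! hc
    refine hω (count_lt_of_forall fun T hT hall => ?_)
    obtain ⟨y, hy, hn⟩ := hc T (Finset.mem_powersetCard.2 ⟨Finset.subset_univ _, hT⟩)
    exact hn (hall y hy)
  · refine (Finset.sum_le_card_nsmul _ _ _ fun T hT => h T (Finset.mem_powersetCard.1 hT).2).trans
      (le_of_eq ?_)
    rw [Finset.card_powersetCard, Finset.card_univ, Fintype.card_fin, nsmul_eq_mul]

theorem uniformProb_forall_and_le {Ω : Type} [Fintype Ω] {Q : Fin n → Prop} {P : Ω → Fin n → Prop}
    {T : Finset (Fin n)} {q : ℝ} (hq : 0 ≤ q)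
    (h : (∀ y ∈ T, Q y) → uniformProb (fun ω => ∀ y ∈ T, P ω y) ≤ q) :
    uniformProb (fun ω => ∀ y ∈ T, Q y ∧ P ω y) ≤ q := by
  by_cases hT : ∀ y ∈ T, Q y
  · exact (uniformProb_mono fun ω hω y hy => (hω y hy).2).trans (h hT)
  · refine (uniformProb_le_sum _ (fun _ => 0) (fun _ => le_rfl) fun ω hω => ?_).trans ?_
    · exact absurd (fun y hy => (hω y hy).1) hT
    · simpa using hq

/-- The linear prefactor from the union bound over initial segments costs only half of the exponent
once `d` is huge. -/
theorem mul_exp_le {a b : ℝ} (hd : 10 ^ 20 ≤ d) (ha : a ≤ 10 ^ 4)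
    (hab : b ≤ -(1 / 500000 * d)) : a * d * Real.exp b ≤ Real.exp (-(1 / 10 ^ 6 * d)) := by
  have h1 : a * d ≤ Real.exp (1 / 10 ^ 6 * d) := by
    have h2 := Real.quadratic_le_exp_of_nonneg (x := 1 / 10 ^ 6 * d) (by positivity)
    nlinarith
  calc a * d * Real.exp b ≤ Real.exp (1 / 10 ^ 6 * d) * Real.exp (-(1 / 500000 * d)) := by gcongr
    _ = Real.exp (-(1 / 10 ^ 6 * d)) := by rw [← Real.exp_add]; congr 1; ring

theorem uniformProb_orderBad_le (hd : 10 ^ 20 ≤ d) (r : ℕ) :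
    uniformProb (fun π : EdgeOrder F =>
      ¬ count (fun y => Regular d φ F y ∧ OrderBad d φ F π y) < r)
      ≤ n.choose r * Real.exp (-(1 / 10 ^ 6 * d)) ^ r := by
  have hd0 : 0 ≤ d := le_trans (by norm_num) hd
  refine uniformProb_count_le (fun (π : EdgeOrder F) y => Regular d φ F y ∧ OrderBad d φ F π y) r
    fun T hT => uniformProb_forall_and_le (by positivity) fun hR => ?_
  -- The slack `D - D₀` is `d / 60`, and `l = (d / 60) / (20 * d)` minimises the exponent.
  have h := uniformProb_order_excess_le (m := (edges F).card) target (edgeSign φ F) edgeSign_eq T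
    (K := 20 * d) (D₀ := d / 60) (D := d / 30) (l := 1 / 1200) (by norm_num) (by positivity)
    (by positivity) (fun y hy => by rw [card_target_eq]; exact (hR y hy).degree)
    (fun y hy => by rw [sum_edgeSign]; exact (hR y hy).balance)
  rw [hT] at h
  refine h.trans (pow_le_pow_left₀ (by positivity) ?_ r)
  rw [← mul_assoc]
  exact mul_exp_le hd (by norm_num) (by linarith)

theorem uniformProb_bitsBad_le (hd : 10 ^ 20 ≤ d) (π : EdgeOrder F) (r : ℕ) :
    uniformProb (fun α : Messages F =>
      ¬ count (fun y => Regular d φ F y ∧ ¬ OrderBad d φ F π y ∧ BitsBad d φ F α π y) < r)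
      ≤ n.choose r * Real.exp (-(1 / 10 ^ 6 * d)) ^ r := by
  have hd0 : 0 ≤ d := le_trans (by norm_num) hd
  simp only [← and_assoc]
  refine uniformProb_count_le (fun (α : Messages F) y =>
    (Regular d φ F y ∧ ¬ OrderBad d φ F π y) ∧ BitsBad d φ F α π y) r
    fun T hT => uniformProb_forall_and_le (by positivity) fun hR => ?_
  -- The minimising value is `l = (d / 30) / (20 * d)`.
  have h := uniformProb_bits_excess_le target (edgeSign φ F) abs_edgeSign_le T π
    (K := 20 * d) (D := d / 30) (l := 1 / 600) (by norm_num)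
    (by positivity) (fun y hy => by rw [card_target_eq]; exact (hR y hy).1.degree)
    (fun y hy => by simpa only [OrderBad, not_exists, not_lt] using (hR y hy).2)
  rw [hT] at h
  refine h.trans (pow_le_pow_left₀ (by positivity) ?_ r)
  rw [← mul_assoc]
  exact mul_exp_le hd (by norm_num) (by linarith)

theorem uniformProb_suppBad_le (hd : 0 ≤ d) (r : ℕ) :
    uniformProb (fun α : Messages F =>
      ¬ count (fun y => Regular d φ F y ∧ SuppBad d φ F α y) < r)
      ≤ n.choose r * Real.exp (-(1 / 10 ^ 6 * d)) ^ r := by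
  refine uniformProb_count_le (fun (α : Messages F) y => Regular d φ F y ∧ SuppBad d φ F α y) r
    fun T hT => uniformProb_forall_and_le (by positivity) fun hR => ?_
  have h := uniformProb_bits_low_le target (edgeSupp φ F) edgeSupp_eq T
    (W := d / 3) (D := d / 7) (l := 1 / 10) (by norm_num) (by norm_num)
    (fun y hy => by rw [sum_edgeSupp]; exact (hR y hy).supp.le)
  rw [hT] at h
  exact h.trans (pow_le_pow_left₀ (by positivity) (Real.exp_le_exp.2 (by linarith)) r)

/-- This is `n.choose r ≤ (e n / r) ^ r`, with `A` an upper bound for `n / r`. -/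
theorem choose_le_exp {r : ℕ} {A x : ℝ} (hr : 1 ≤ r) (hA : (n : ℝ) ≤ A * r)
    (hx : Real.exp 1 * A ≤ Real.exp x) : (n.choose r : ℝ) ≤ Real.exp (x * r) := by
  have hr' : (0 : ℝ) < r := by exact_mod_cast hr
  have h1 : (n.choose r : ℝ) ≤ (n : ℝ) ^ r / r.factorial := Nat.choose_le_pow_div r n
  have h2 : (r : ℝ) ^ r / r.factorial ≤ Real.exp r := Real.pow_div_factorial_le_exp r hr'.le r
  have hA0 : 0 ≤ A := by
    by_contra! hA0
    have : (0 : ℝ) ≤ n := n.cast_nonneg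
    nlinarith
  calc (n.choose r : ℝ) ≤ (A * r) ^ r / r.factorial := h1.trans (by gcongr)
    _ = A ^ r * ((r : ℝ) ^ r / r.factorial) := by rw [mul_pow]; ring
    _ ≤ A ^ r * Real.exp r := by gcongr
    _ = (Real.exp 1 * A) ^ r := by rw [mul_pow, ← Real.exp_nat_mul, mul_one, mul_comm]
    _ ≤ Real.exp x ^ r := by gcongr
    _ = Real.exp (x * r) := by rw [← Real.exp_nat_mul, mul_comm]

variable {p : ℝ}

theorem formulaProb_not_forall_le (h0 : 0 ≤ p) (h1 : p ≤ 1) {r : ℕ}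
    (E : Finset (Fin n) → Formula n → Prop) {q : ℝ}
    (h : ∀ T : Finset (Fin n), T.card = r → formulaProb p φ (fun F => ¬ E T F) ≤ q) :
    formulaProb p φ (fun F => ¬ ∀ T : Finset (Fin n), T.card = r → E T F) ≤ n.choose r * q := by
  refine (formulaProb_mono h0 h1 (E' := fun F => ∃ T ∈ Finset.powersetCard r Finset.univ,
    ¬ E T F) fun F hF => ?_).trans ((formulaProb_exists_le h0 h1 _ _).trans ?_)
  · push Not at hF
    obtain ⟨T, hT, hn⟩ := hF
    exact ⟨T, Finset.mem_powersetCard.2 ⟨Finset.subset_univ _, hT⟩, hn⟩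
  · refine (Finset.sum_le_card_nsmul _ _ _ fun T hT => h T (Finset.mem_powersetCard.1 hT).2).trans
      (le_of_eq ?_)
    rw [Finset.card_powersetCard, Finset.card_univ, Fintype.card_fin, nsmul_eq_mul]

theorem formulaProb_not_good_le (h0 : 0 ≤ p) (h1 : p ≤ 1) (hd : d = (n : ℝ) ^ 2 * p)
    (hd0 : 0 ≤ d) (hn : 1000 ≤ n) {r t : ℕ} {q q' : ℝ}
    (hq : n.choose r * Real.exp (-(1 / 10 ^ 6 * (d * r))) ≤ q)
    (hq' : n.choose t * Real.exp (16 * ((t : ℝ) ^ 2 * n * p) - t * d / 180) ≤ q') :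
    formulaProb p φ (fun F => ¬ FormulaGood d r t φ F) ≤ 4 * q + q' := by
  have key : ∀ {a : ℝ}, 1 / 10 ^ 6 ≤ a →
      n.choose r * Real.exp (-(a * (d * r))) ≤ q := fun {a} ha => by
    refine le_trans ?_ hq
    have : (0 : ℝ) ≤ d * r := by positivity
    gcongr
  have e1 : formulaProb p φ (fun F => ¬ ∀ T : Finset (Fin n), T.card = r →
      ∑ y ∈ T, (degree F y : ℝ) < 20 * d * T.card) ≤ q :=
    (formulaProb_not_forall_le h0 h1 _ fun T hT => by
      simp only [not_lt]
      have := formulaProb_degree_le (φ := φ) h0 h1 T hd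
      rwa [hT] at this ⊢).trans (key (by norm_num))
  have e2 : formulaProb p φ (fun F => ¬ ∀ T : Finset (Fin n), T.card = r →
      d / 3 * T.card < ∑ y ∈ T, ((Nsupp φ F y).card : ℝ)) ≤ q :=
    (formulaProb_not_forall_le h0 h1 _ fun T hT => by
      simp only [not_lt]
      have := formulaProb_Nsupp_le (φ := φ) h0 h1 T hd hn
      rwa [hT] at this ⊢).trans (key (by norm_num))
  have e3 : formulaProb p φ (fun F => ¬ ∀ T : Finset (Fin n), T.card = r →
      ∑ y ∈ T, 1 * (((Npp φ F y).card : ℝ) - ((Nneg φ F y).card : ℝ)) < d / 60 * T.card) ≤ q :=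
    (formulaProb_not_forall_le h0 h1 _ fun T hT => by
      simp only [not_lt]
      have := formulaProb_balance_le (φ := φ) h0 h1 T hd (η := 1) (by norm_num)
      rwa [hT] at this ⊢).trans (key (by norm_num))
  have e4 : formulaProb p φ (fun F => ¬ ∀ T : Finset (Fin n), T.card = r →
      ∑ y ∈ T, -1 * (((Npp φ F y).card : ℝ) - ((Nneg φ F y).card : ℝ)) < d / 60 * T.card) ≤ q :=
    (formulaProb_not_forall_le h0 h1 _ fun T hT => by
      simp only [not_lt]
      have := formulaProb_balance_le (φ := φ) h0 h1 T hd (η := -1) (by norm_num)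
      rwa [hT] at this ⊢).trans (key (by norm_num))
  have e5 : formulaProb p φ (fun F => ¬ ∀ U : Finset (Fin n), U.card = t →
      ((F.filter fun C => 2 ≤ (vars C ∩ U).card).card : ℝ) < t * d / 180) ≤ q' :=
    (formulaProb_not_forall_le h0 h1 _ fun U hU => by
      simp only [not_lt]
      have := formulaProb_dense_le (φ := φ) h0 h1 U (t * d / 180)
      rwa [hU] at this).trans hq'
  refine (formulaProb_mono h0 h1 (E' := fun F => _ ∨ _ ∨ _ ∨ _ ∨ _) fun F hF => ?_).trans
    ((formulaProb_or_le h0 h1 _ _).trans ((add_le_add e1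
    ((formulaProb_or_le h0 h1 _ _).trans (add_le_add e2
    ((formulaProb_or_le h0 h1 _ _).trans (add_le_add e3
    ((formulaProb_or_le h0 h1 _ _).trans (add_le_add e4 e5))))))).trans (by linarith)))
  by_contra! hc
  exact hF ⟨hc.1, hc.2.1, hc.2.2.1, hc.2.2.2.1, hc.2.2.2.2⟩

noncomputable instance : Fintype (Messages F × EdgeOrder F) := instFintypeProd _ _

theorem FormulaGood.uniformProb_core_ge {r t : ℕ} (hF : FormulaGood d r t φ F)
    (hd : 10 ^ 20 ≤ d) (hrn : r ≤ n) (hr : 1 ≤ r) (hrt : 2000 * d * ((r : ℝ) - 1) ≤ t) {q : ℝ}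
    (hq : n.choose r * Real.exp (-(1 / 10 ^ 6 * (d * r))) ≤ q) :
    1 - 3 * q ≤ uniformProb fun ω : Messages F × EdgeOrder F =>
      ∀ H, IsCore d φ F ω.1 ω.2 H → (Finset.univ \ H).card < t := by
  have hq1 : n.choose r * Real.exp (-(1 / 10 ^ 6 * d)) ^ r ≤ q := by
    refine le_trans (le_of_eq ?_) hq
    rw [← Real.exp_nat_mul]
    congr 2
    ring
  have hq0 : 0 ≤ q := le_trans (by positivity) hq
  have e1 : uniformProb (fun ω : Messages F × EdgeOrder F =>
      ¬ count (fun y => Regular d φ F y ∧ OrderBad d φ F ω.2 y) < r) ≤ q :=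
    uniformProb_prod_le_of_fst _ hq0 fun α => (uniformProb_orderBad_le hd r).trans hq1
  have e2 : uniformProb (fun ω : Messages F × EdgeOrder F =>
      ¬ count (fun y => Regular d φ F y ∧ ¬ OrderBad d φ F ω.2 y ∧ BitsBad d φ F ω.1 ω.2 y) < r)
      ≤ q :=
    uniformProb_prod_le_of_snd _ hq0 fun π => (uniformProb_bitsBad_le hd π r).trans hq1
  have e3 : uniformProb (fun ω : Messages F × EdgeOrder F =>
      ¬ count (fun y => Regular d φ F y ∧ SuppBad d φ F ω.1 y) < r) ≤ q :=
    uniformProb_prod_le_of_snd _ hq0 fun π =>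
      (uniformProb_suppBad_le (le_trans (by norm_num) hd) r).trans hq1
  have : Nonempty (EdgeOrder F) := ⟨(edges F).equivFin⟩
  refine le_trans ?_ (one_sub_uniformProb_not_le _)
  refine sub_le_sub_left ((uniformProb_mono (E' := fun ω => _ ∨ _ ∨ _) fun ω hω => ?_).trans
    ((uniformProb_or_le _ _).trans ((add_le_add e1 ((uniformProb_or_le _ _).trans
    (add_le_add e2 e3))).trans (by linarith)))) 1
  by_contra! hc
  exact hω fun H hH => hF.card_compl_core_lt (le_trans (by norm_num) hd) hrn hr hrt hc.1 hc.2.1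
    hc.2.2 hH

theorem sum_plantedWeight_mul_ge (h0 : 0 ≤ p) (h1 : p ≤ 1) (G : Formula n → Prop)
    (u : Formula n → ℝ) {a b : ℝ} (ha : formulaProb p φ (fun F => ¬ G F) ≤ a) (hb : 0 ≤ b)
    (hu0 : ∀ F, 0 ≤ u F) (hu : ∀ F, G F → 1 - b ≤ u F) :
    1 - (a + b) ≤ ∑ F ∈ (satClauses φ).powerset, plantedWeight p φ F * u F := by
  have h : ∑ F ∈ (satClauses φ).powerset, plantedWeight p φ F * (1 - b)
      - formulaProb p φ (fun F => ¬ G F)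
      ≤ ∑ F ∈ (satClauses φ).powerset, plantedWeight p φ F * u F := by
    rw [formulaProb, ← Finset.sum_sub_distrib]
    refine Finset.sum_le_sum fun F _ => ?_
    rw [← mul_sub]
    refine mul_le_mul_of_nonneg_left ?_ (plantedWeight_nonneg h0 h1 F)
    by_cases hG : G F
    · simpa [hG] using hu F hG
    · simp only [hG, not_false_eq_true, if_true]
      linarith [hu0 F]
  rw [← Finset.sum_mul, sum_plantedWeight] at h
  linarith

theorem plantedProb_le_one (h0 : 0 ≤ p) (h1 : p ≤ 1)
    (E : (φ : Assignment n) → (F : Formula n) → Messages F → EdgeOrder F → Prop) :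
    plantedProb n p E ≤ 1 := by
  have h : ∀ φ : Assignment n, ∑ F ∈ (satClauses φ).powerset, plantedWeight p φ F *
      uniformProb (fun ω : Messages F × EdgeOrder F => E φ F ω.1 ω.2) ≤ 1 := fun φ => by
    rw [← sum_plantedWeight (p := p) (φ := φ)]
    exact Finset.sum_le_sum fun F _ =>
      mul_le_of_le_one_right (plantedWeight_nonneg h0 h1 F) (uniformProb_le_one _)
  refine (Finset.sum_le_sum fun φ _ => mul_le_mul_of_nonneg_left (h φ) (by positivity)).trans ?_
  simp

theorem le_plantedProb {a : ℝ}
    (E : (φ : Assignment n) → (F : Formula n) → Messages F → EdgeOrder F → Prop)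
    (h : ∀ φ : Assignment n, a ≤ ∑ F ∈ (satClauses φ).powerset, plantedWeight p φ F *
      uniformProb (fun ω : Messages F × EdgeOrder F => E φ F ω.1 ω.2)) :
    a ≤ plantedProb n p E := by
  refine le_trans (le_of_eq ?_)
    (Finset.sum_le_sum fun φ _ => mul_le_mul_of_nonneg_left (h φ) (by positivity))
  simp

/-- The bound for a single, large `n`. -/
theorem plantedProb_core_ge (hn : 12800 ≤ n) (h1 : p ≤ 1) (hd : d = (n : ℝ) ^ 2 * p)
    (hd0 : 10 ^ 20 ≤ d) :
    1 - 8 / (n : ℝ) ≤ plantedProb n p fun φ F α π =>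
      ∀ H : Finset (Fin n), IsCore d φ F α π H →
        (1 - Real.exp (-(1 / 10 ^ 7 * d))) * (n : ℝ) ≤ (H.card : ℝ) := by
  have hn' : (12800 : ℝ) ≤ n := by exact_mod_cast hn
  have hdpos : 0 < d := lt_of_lt_of_le (by norm_num) hd0
  have h0 : 0 ≤ p := by
    by_contra! hp
    have : (0 : ℝ) < (n : ℝ) ^ 2 := by positivity
    nlinarith
  set s : ℝ := Real.exp (-(1 / 10 ^ 7 * d)) * n with hs
  have hs0 : 0 ≤ s := by positivity
  set t : ℕ := ⌊s⌋₊ + 1 with ht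
  have hst : s < t := by rw [ht]; push_cast; exact Nat.lt_floor_add_one s
  have hts : (t : ℝ) ≤ s + 1 := by rw [ht]; push_cast; linarith [Nat.floor_le hs0]
  have ht1 : (1 : ℝ) ≤ t := by rw [ht]; push_cast; linarith [(Nat.cast_nonneg ⌊s⌋₊ : (0 : ℝ) ≤ _)]
  set r : ℕ := ⌊(t : ℝ) / (2000 * d)⌋₊ + 1 with hr
  have hr1 : 1 ≤ r := by omega
  have hr1' : (1 : ℝ) ≤ r := by exact_mod_cast hr1
  have hrt : 2000 * d * ((r : ℝ) - 1) ≤ t := by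
    have := Nat.floor_le (show 0 ≤ (t : ℝ) / (2000 * d) by positivity)
    rw [le_div_iff₀ (by positivity)] at this
    rw [hr]; push_cast; linarith
  have htr : (t : ℝ) ≤ 2000 * d * r := by
    have := (Nat.lt_floor_add_one ((t : ℝ) / (2000 * d))).le
    rw [div_le_iff₀ (by positivity)] at this
    rw [hr]; push_cast; linarith
  have hrlet : r ≤ t := by
    have h2 : (r : ℝ) - 1 < t := by nlinarith
    have h3 : r < t + 1 := by exact_mod_cast (by linarith : (r : ℝ) < t + 1)
    omega
  have hexp : Real.exp (-(1 / 10 ^ 7 * d)) ≤ 1 / 12800 := by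
    rw [Real.exp_neg, inv_eq_one_div]
    refine one_div_le_one_div_of_le (by norm_num) ?_
    linarith [Real.add_one_le_exp (1 / 10 ^ 7 * d)]
  -- Both `s` and the rounding error `1` are at most `n / 12800`.
  have htn : (t : ℝ) ≤ n / 6400 := by nlinarith
  have htn' : t ≤ n := by exact_mod_cast (by linarith : (t : ℝ) ≤ n)
  have hnt : (n : ℝ) ≤ Real.exp (1 / 10 ^ 7 * d) * t := by
    have h2 : Real.exp (1 / 10 ^ 7 * d) * s = n := by
      rw [hs, ← mul_assoc, ← Real.exp_add, add_neg_cancel, Real.exp_zero, one_mul]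
    rw [← h2]
    gcongr
  have hlarge : ∀ x : ℝ, d ≤ x → 6000 * x ≤ Real.exp (1 / 10 ^ 7 * x) := fun x hx => by
    have h2 := Real.quadratic_le_exp_of_nonneg (x := 1 / 10 ^ 7 * x) (by nlinarith)
    nlinarith
  have hnr : (n : ℝ) ≤ (2000 * d * Real.exp (1 / 10 ^ 7 * d)) * r := by
    refine hnt.trans ?_
    rw [mul_comm (2000 * d), mul_assoc]
    gcongr
  have hdr : d ≤ d * r := by nlinarith
  have hdrt : d * r ≤ d * t := by gcongr
  -- Even a factor exponentially small in `d * r` is at most `1 / n`, because `n / r` is only `2000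
  -- * d * e^{d / 10⁷}`. This gives convergence also for constant `d`.
  have hn_le : (n : ℝ) ≤ Real.exp (2 / 10 ^ 7 * (d * r)) := by
    have h2 := hlarge _ hdr
    calc (n : ℝ) ≤ (2000 * d * Real.exp (1 / 10 ^ 7 * d)) * r := hnr
      _ = (2000 * (d * r)) * Real.exp (1 / 10 ^ 7 * d) := by ring
      _ ≤ Real.exp (1 / 10 ^ 7 * (d * r)) * Real.exp (1 / 10 ^ 7 * (d * r)) := by
        gcongr
        nlinarith
      _ = Real.exp (2 / 10 ^ 7 * (d * r)) := by rw [← Real.exp_add]; congr 1; ring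
  have hsmall : ∀ x : ℝ, x ≤ -(2 / 10 ^ 7 * (d * r)) → Real.exp x ≤ 1 / n := fun x hx => by
    refine (Real.exp_le_exp.2 hx).trans ?_
    rw [Real.exp_neg, inv_eq_one_div]
    exact one_div_le_one_div_of_le (by linarith) hn_le
  have he : Real.exp 1 ≤ 3 := by linarith [Real.exp_one_lt_d9]
  have hq : n.choose r * Real.exp (-(1 / 10 ^ 6 * (d * r))) ≤ 1 / (n : ℝ) := by
    have h2 : (n.choose r : ℝ) ≤ Real.exp (2 / 10 ^ 7 * d * r) := by
      refine choose_le_exp hr1 hnr ?_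
      calc Real.exp 1 * (2000 * d * Real.exp (1 / 10 ^ 7 * d))
          ≤ 3 * (2000 * d * Real.exp (1 / 10 ^ 7 * d)) := by gcongr
        _ = (6000 * d) * Real.exp (1 / 10 ^ 7 * d) := by ring
        _ ≤ Real.exp (1 / 10 ^ 7 * d) * Real.exp (1 / 10 ^ 7 * d) := by
          gcongr
          exact hlarge d le_rfl
        _ = Real.exp (2 / 10 ^ 7 * d) := by rw [← Real.exp_add]; congr 1; ring
    refine (mul_le_mul_of_nonneg_right h2 (by positivity)).trans ?_
    rw [← Real.exp_add]
    refine hsmall _ ?_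
    nlinarith
  have hq' : n.choose t * Real.exp (16 * ((t : ℝ) ^ 2 * n * p) - t * d / 180) ≤ 1 / (n : ℝ) := by
    have h2 : (n.choose t : ℝ) ≤ Real.exp ((1 + 1 / 10 ^ 7 * d) * t) := by
      refine choose_le_exp (by omega) hnt ?_
      rw [← Real.exp_add]
    refine (mul_le_mul_of_nonneg_right h2 (by positivity)).trans ?_
    rw [← Real.exp_add]
    refine hsmall _ ?_
    -- By `t ≤ n / 6400` the moment term is at most `t * d / 400`, safely below `t * d / 180`; the
    -- difference also absorbs the entropy `(1 + d / 10⁷) * t`.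
    have h3 : (t : ℝ) ^ 2 * n * p ≤ t * d / 6400 := by
      have h4 : (t : ℝ) * (t * (n * p)) ≤ t * (n / 6400 * (n * p)) := by gcongr
      rw [hd]
      nlinarith
    have h5 : 10 ^ 20 * (t : ℝ) ≤ d * t := by gcongr
    linarith
  refine le_plantedProb _ fun φ => ?_
  have h2 := sum_plantedWeight_mul_ge h0 h1 (FormulaGood d r t φ)
    (fun F => uniformProb fun ω : Messages F × EdgeOrder F =>
      ∀ H : Finset (Fin n), IsCore d φ F ω.1 ω.2 H →
        (1 - Real.exp (-(1 / 10 ^ 7 * d))) * (n : ℝ) ≤ (H.card : ℝ))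
    (formulaProb_not_good_le (φ := φ) h0 h1 hd hdpos.le (by omega) hq hq')
    (b := 3 * (1 / (n : ℝ))) (by positivity) (fun F => uniformProb_nonneg _) fun F hF =>
      (hF.uniformProb_core_ge hd0 (hrlet.trans htn') hr1 hrt hq).trans
        (uniformProb_mono fun ω hω H hH => ?_)
  -- Four conditions on `r`-sets, the density condition and three conditions on order and messages
  -- each fail with probability at most `1 / n`, which gives `8 / n`.
  · refine le_trans (le_of_eq ?_) h2
    ring
  · have h3 : (Finset.univ \ H).card ≤ ⌊s⌋₊ := Nat.lt_succ_iff.1 (hω H hH)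
    have h4 : ((Finset.univ \ H).card : ℝ) ≤ s := (Nat.cast_le.2 h3).trans (Nat.floor_le hs0)
    have h5 := Finset.card_sdiff_add_card_eq_card (Finset.subset_univ H)
    rw [Finset.card_univ, Fintype.card_fin] at h5
    have h6 : ((Finset.univ \ H).card : ℝ) + H.card = n := by exact_mod_cast h5
    rw [sub_mul, one_mul, ← hs]
    linarith

end Estimates

end PlantedSAT

theorem mainTheorem4 :
    ∃ c : ℝ, 0 < c ∧ ∃ d₀ : ℝ, 0 < d₀ ∧
      ∀ p d : ℕ → ℝ,
        (∀ n, d n = (n : ℝ) ^ 2 * p n) →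
        (∀ᶠ n in atTop, d₀ ≤ d n ∧ p n ≤ 1) →
        Tendsto
          (fun n : ℕ => PlantedSAT.plantedProb n (p n) fun φ F α π =>
            ∀ H : Finset (Fin n), PlantedSAT.IsCore (d n) φ F α π H →
              (1 - Real.exp (-(c * d n))) * (n : ℝ) ≤ (H.card : ℝ))
          atTop (𝓝 1) := by
  -- The threshold `10 ^ 20` is chosen so that `e^{d / 10⁷}` dominates the linear factors in `d` of
  -- all union bounds.
  refine ⟨1 / 10 ^ 7, by norm_num, 10 ^ 20, by norm_num, fun p d hd hev => ?_⟩
  have hlim : Tendsto (fun n : ℕ => 1 - 8 / (n : ℝ)) atTop (𝓝 1) := by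
    simpa using (tendsto_const_div_atTop_nhds_zero_nat (8 : ℝ)).const_sub 1
  refine tendsto_of_tendsto_of_tendsto_of_le_of_le' hlim tendsto_const_nhds ?_ ?_
  · filter_upwards [hev, eventually_ge_atTop 12800] with n hn hn'
    exact PlantedSAT.plantedProb_core_ge hn' hn.2 (hd n) hn.1
  · filter_upwards [hev, eventually_ge_atTop 12800] with n hn hn'
    refine PlantedSAT.plantedProb_le_one ?_ hn.2 _
    -- Nonnegativity of `p n` follows from `n ^ 2 * p n = d n > 0`.
    by_contra! hp
    have h1 : (0 : ℝ) ≤ (n : ℝ) ^ 2 := by positivity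
    have h2 := hn.1
    rw [hd n] at h2
    nlinarith
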